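/- Let $\lambda=(\lambda_n)_n$ be a frequency, i.e. a strictly increasing sequence of non-negative real numbers tending to $\infty$. Let $\mathcal D^{ext}_\infty(\lambda)$ be the complex vector space of all formal Dirichlet series $D=\sum_n a_n(D)e^{-\lambda_n s}$ (with complex coefficients) that converge at some point $s\in\mathbb C$ and whose limit function extends to a bounded holomorphic function $F$ on the open half-plane $[\operatorname{Re}>0]$; put $\|D\|_\infty:=\sup_{\operatorname{Re}s>0}|F(s)|$. A pair $(G,\beta)$ is called a $\lambda$-Dirichlet group if $G$ is a compact (Hausdorff) abelian group, $\beta\colon\mathbb R\to G$ is a continuous homomorphism with dense range, and for every $n$ there is a (necessarily unique) continuous character $h_{\lambda_n}\colon G\to\mathbb T$ with $h_{\lambda_n}(\beta(t))=e^{-i\lambda_n t}$ for all $t\in\mathbb R$. For $f\in L_\infty(G)$ (with respect to the normalized Haar measure) and $\gamma$ in the dual group $\widehat G$ let $\widehat f(\gamma)=\int_G f\,\overline{\gamma}$, and let $H^\lambda_\infty(G)$ be the subspace of all $f\in L_\infty(G)$ such that $\widehat f(\gamma)\neq0$ only if $\gamma=h_{\lambda_n}$ for some $n$, with the norm of $L_\infty(G)$.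 Then: (1) For every $\lambda$-Dirichlet group $(G,\beta)$ there is an injective linear map $\Psi\colon\mathcal D^{ext}_\infty(\lambda)\to H^\lambda_\infty(G)$ with $\|\Psi(D)\|_\infty\le\|D\|_\infty$ for all $D$ and $a_n(D)=\widehat{\Psi(D)}(h_{\lambda_n})$ for all $D$ and all $n$. (2) For every $D\in\mathcal D^{ext}_\infty(\lambda)$ with Dirichlet coefficients $(a_n)_n$ the series $\sum_n|a_n|^2$ converges and $\left(\sum_n|a_n|^2\right)^{1/2}\le\|D\|_\infty$. -/

import Mathlib

open MeasureTheory Filter Topology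
open scoped ENNReal

noncomputable section

namespace GenDirichlet

/-! ### Frequencies and general Dirichlet series -/

/-- A frequency: a non-negative, strictly increasing sequence of reals tending to infinity. -/
structure Frequency where
  /-- The terms of the frequency. -/
  seq : ℕ → ℝ
  nonneg : ∀ n, 0 ≤ seq n
  strictMono : StrictMono seq
  tendsto_atTop : Tendsto seq atTop atTop

/-- The partial sum of the first `N` terms of the formal Dirichlet series
`∑ a n * exp (-lam n * s)`. A formal `lam`-Dirichlet series is given by its sequence
`a : ℕ → ℂ` of Dirichlet coefficients. -/
def partialSum (lam : Frequency) (a : ℕ → ℂ) (s : ℂ) (N : ℕ) : ℂ :=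
  ∑ n ∈ Finset.range N, a n * Complex.exp (-(lam.seq n : ℂ) * s)

/-- The Dirichlet series with coefficients `a` converges at `s` with sum `l`. -/
def HasSumAt (lam : Frequency) (a : ℕ → ℂ) (s l : ℂ) : Prop :=
  Tendsto (partialSum lam a s) atTop (𝓝 l)

/-- `f` is a bounded holomorphic extension to the open right half-plane of the Dirichlet series
with coefficients `a`: `f` is holomorphic and bounded on `Re > 0` and agrees there with the sum
of the series at the points of convergence lying in some half-plane. (For a somewhere convergent
series, agreement on some half-plane and agreement on `Re > max 0 σ_c` are the same by the
identity theorem.) -/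
structure IsBoundedExtension (lam : Frequency) (a : ℕ → ℂ) (f : ℂ → ℂ) : Prop where
  holomorphic : DifferentiableOn ℂ f {s : ℂ | 0 < s.re}
  bounded : ∃ C : ℝ, ∀ s : ℂ, 0 < s.re → ‖f s‖ ≤ C
  extend : ∃ σ : ℝ, ∀ s : ℂ, 0 < s.re → σ < s.re → ∀ l : ℂ, HasSumAt lam a s l → f s = l

/-! The next three facts (a Dirichlet series converges to the right of any point of convergence)
are only needed to see that the space defined below is closed under addition. -/

lemma norm_exp_sub_exp_le {w : ℂ} (hw : 0 < w.re) {x y : ℝ} (hxy : x ≤ y) :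
    ‖Complex.exp (-(x : ℂ) * w) - Complex.exp (-(y : ℂ) * w)‖ ≤
      ‖w‖ / w.re * (Real.exp (-x * w.re) - Real.exp (-y * w.re)) := by
  have h1 : ∫ t in x..y, -w * Complex.exp (-w * (t : ℂ)) =
      Complex.exp (-(y : ℂ) * w) - Complex.exp (-(x : ℂ) * w) := by
    have hne : -w ≠ 0 := by
      intro h
      have : w = 0 := by simpa using h
      simp [this] at hw
    rw [intervalIntegral.integral_const_mul, integral_exp_mul_complex hne]
    field_simp
    rw [mul_comm w (y : ℂ), mul_comm w (x : ℂ)]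
    have hw0 : w ≠ 0 := neg_ne_zero.mp hne
    field_simp
  have h2 : ∫ t in x..y, ‖w‖ * Real.exp (-w.re * t) =
      ‖w‖ / w.re * (Real.exp (-x * w.re) - Real.exp (-y * w.re)) := by
    have hne : (-w.re) ≠ 0 := by linarith
    rw [intervalIntegral.integral_const_mul,
      intervalIntegral.integral_comp_mul_left (fun t => Real.exp t) hne, integral_exp]
    simp only [smul_eq_mul]
    rw [show -w.re * y = -y * w.re by ring, show -w.re * x = -x * w.re by ring]
    field_simp
    ring
  rw [norm_sub_rev, ← h1, ← h2]
  refine (intervalIntegral.norm_integral_le_integral_norm hxy).trans (le_of_eq ?_)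
  refine intervalIntegral.integral_congr fun t _ => ?_
  simp [Complex.norm_exp]

lemma summable_norm_exp_sub (lam : Frequency) {w : ℂ} (hw : 0 < w.re) :
    Summable fun n => ‖Complex.exp (-(lam.seq n : ℂ) * w) -
      Complex.exp (-(lam.seq (n + 1) : ℂ) * w)‖ := by
  refine summable_of_sum_range_le (c := ‖w‖ / w.re * Real.exp (-lam.seq 0 * w.re))
    (fun n => norm_nonneg _) fun N => ?_
  refine (Finset.sum_le_sum fun n _ =>
    norm_exp_sub_exp_le hw (lam.strictMono.monotone n.le_succ)).trans ?_
  rw [← Finset.mul_sum, Finset.sum_range_sub' (fun n => Real.exp (-lam.seq n * w.re))]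
  have := (Real.exp_pos (-lam.seq N * w.re)).le
  gcongr
  linarith

lemma exists_hasSumAt_of_re_lt (lam : Frequency) {a : ℕ → ℂ} {s₀ s l₀ : ℂ}
    (h : HasSumAt lam a s₀ l₀) (hs : s₀.re < s.re) : ∃ l, HasSumAt lam a s l := by
  set w := s - s₀ with hwdef
  have hw : 0 < w.re := by simp [hwdef, hs]
  set c : ℕ → ℂ := fun n => Complex.exp (-(lam.seq n : ℂ) * w) with hc
  set B : ℕ → ℂ := partialSum lam a s₀ with hB
  have hc0 : Tendsto c atTop (𝓝 0) := by
    rw [tendsto_zero_iff_norm_tendsto_zero]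
    have : (fun n => ‖c n‖) = fun n => Real.exp (-(lam.seq n * w.re)) := by
      funext n
      simp [hc, Complex.norm_exp]
    rw [this]
    exact Real.tendsto_exp_neg_atTop_nhds_zero.comp (lam.tendsto_atTop.atTop_mul_const hw)
  obtain ⟨M, hM⟩ := (Metric.isBounded_range_of_tendsto B h).exists_norm_le
  have hsum : Summable fun n => B (n + 1) * (c n - c (n + 1)) := by
    refine Summable.of_norm_bounded (g := fun n => M * ‖c n - c (n + 1)‖)
      ((summable_norm_exp_sub lam hw).mul_left M) fun n => ?_
    rw [norm_mul]
    exact mul_le_mul_of_nonneg_right (hM _ ⟨_, rfl⟩) (norm_nonneg _)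
  have key : ∀ N, partialSum lam a s N =
      B N * c N + ∑ n ∈ Finset.range N, B (n + 1) * (c n - c (n + 1)) := by
    intro N
    induction N with
    | zero => simp [partialSum, hB]
    | succ N ih =>
      have e1 : partialSum lam a s (N + 1) = partialSum lam a s N +
          a N * Complex.exp (-(lam.seq N : ℂ) * s₀) * c N := by
        simp only [partialSum, Finset.sum_range_succ, hc, mul_assoc, ← Complex.exp_add]
        congr 4
        rw [hwdef]
        ring
      have e2 : B (N + 1) = B N + a N * Complex.exp (-(lam.seq N : ℂ) * s₀) := by
        simp only [hB, partialSum, Finset.sum_range_succ]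
      rw [e1, ih, Finset.sum_range_succ, e2]
      ring
  refine ⟨l₀ * 0 + ∑' n, B (n + 1) * (c n - c (n + 1)), ?_⟩
  unfold HasSumAt
  rw [funext key]
  exact (Tendsto.mul h hc0).add hsum.hasSum.tendsto_sum_nat

/-- The space `𝓓_∞^ext(lam)` of all somewhere convergent `lam`-Dirichlet series (given by their
coefficients) that have a bounded holomorphic extension to the open right half-plane. -/
def Dext (lam : Frequency) : Submodule ℂ (ℕ → ℂ) where
  carrier := {a | (∃ s l : ℂ, HasSumAt lam a s l) ∧ ∃ f : ℂ → ℂ, IsBoundedExtension lam a f}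
  zero_mem' := by
    have h0 : ∀ s, HasSumAt lam 0 s 0 := fun s => by
      have : partialSum lam 0 s = fun _ => 0 := by
        funext N
        simp [partialSum]
      rw [HasSumAt, this]
      exact tendsto_const_nhds
    exact ⟨⟨0, 0, h0 0⟩, 0, differentiableOn_const _, ⟨0, by simp⟩,
      0, fun s _ _ l hl => tendsto_nhds_unique (h0 s) hl⟩
  add_mem' := by
    rintro a b ⟨⟨s, l, hs⟩, f, hf⟩ ⟨⟨t, m, ht⟩, g, hg⟩
    have hadd : ∀ {z p q : ℂ}, HasSumAt lam a z p → HasSumAt lam b z q →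
        HasSumAt lam (a + b) z (p + q) := by
      intro z p q hp hq
      refine (Tendsto.add hp hq).congr fun N => ?_
      simp [partialSum, add_mul, Finset.sum_add_distrib]
    obtain ⟨C, hC⟩ := hf.bounded
    obtain ⟨C', hC'⟩ := hg.bounded
    obtain ⟨σ, hσ⟩ := hf.extend
    obtain ⟨τ, hτ⟩ := hg.extend
    refine ⟨?_, f + g, hf.holomorphic.add hg.holomorphic, ⟨C + C', fun z hz => ?_⟩,
      max (max σ τ) (max s.re t.re), fun z hz hz' n hn => ?_⟩
    · have h1 : s.re < (((max s.re t.re) + 1 : ℝ) : ℂ).re := by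
        rw [Complex.ofReal_re]
        linarith [le_max_left s.re t.re]
      have h2 : t.re < (((max s.re t.re) + 1 : ℝ) : ℂ).re := by
        rw [Complex.ofReal_re]
        linarith [le_max_right s.re t.re]
      obtain ⟨p, hp⟩ := exists_hasSumAt_of_re_lt lam hs h1
      obtain ⟨q, hq⟩ := exists_hasSumAt_of_re_lt lam ht h2
      exact ⟨_, _, hadd hp hq⟩
    · exact (norm_add_le _ _).trans (add_le_add (hC z hz) (hC' z hz))
    · simp only [max_lt_iff] at hz'
      obtain ⟨p, hp⟩ := exists_hasSumAt_of_re_lt lam hs hz'.2.1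
      obtain ⟨q, hq⟩ := exists_hasSumAt_of_re_lt lam ht hz'.2.2
      rw [Pi.add_apply, hσ z hz hz'.1.1 p hp, hτ z hz hz'.1.2 q hq]
      exact tendsto_nhds_unique (hadd hp hq) hn
  smul_mem' := by
    rintro c a ⟨⟨s, l, hs⟩, f, hf⟩
    have hmul : ∀ {d : ℂ} {e : ℕ → ℂ} {z p : ℂ}, HasSumAt lam e z p →
        HasSumAt lam (d • e) z (d * p) := by
      intro d e z p hp
      refine (Tendsto.const_mul d hp).congr fun N => ?_
      simp [partialSum, Finset.mul_sum, mul_assoc]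
    obtain ⟨C, hC⟩ := hf.bounded
    obtain ⟨σ, hσ⟩ := hf.extend
    refine ⟨⟨s, _, hmul hs⟩, c • f, hf.holomorphic.const_smul c, ⟨‖c‖ * C, fun z hz => ?_⟩,
      max σ s.re, fun z hz hz' n hn => ?_⟩
    · rw [Pi.smul_apply, norm_smul]
      exact mul_le_mul_of_nonneg_left (hC z hz) (norm_nonneg _)
    · simp only [max_lt_iff] at hz'
      obtain ⟨p, hp⟩ := exists_hasSumAt_of_re_lt lam hs hz'.2
      rw [Pi.smul_apply, hσ z hz hz'.1 p hp, smul_eq_mul]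
      exact tendsto_nhds_unique (hmul hp) hn

/-- The bounded holomorphic extension is unique on `Re > 0`. -/
lemma IsBoundedExtension.eqOn {lam : Frequency} {a : ℕ → ℂ} {f g : ℂ → ℂ}
    (ha : ∃ s l : ℂ, HasSumAt lam a s l) (hf : IsBoundedExtension lam a f)
    (hg : IsBoundedExtension lam a g) : Set.EqOn f g {s : ℂ | 0 < s.re} := by
  obtain ⟨s, l, hs⟩ := ha
  obtain ⟨σ, hσ⟩ := hf.extend
  obtain ⟨τ, hτ⟩ := hg.extend
  have hopen : IsOpen {z : ℂ | 0 < z.re} := isOpen_lt continuous_const Complex.continuous_re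
  set M : ℝ := max (max σ τ) (max s.re 0) with hM
  have h0 : 0 ≤ M := (le_max_right s.re 0).trans (le_max_right _ _)
  refine (hf.holomorphic.analyticOnNhd hopen).eqOn_of_preconnected_of_eventuallyEq
    (hg.holomorphic.analyticOnNhd hopen) (convex_halfSpace_re_gt 0).isPreconnected
    (z₀ := ((M + 1 : ℝ) : ℂ)) (by
      rw [Set.mem_ofPred_eq, Complex.ofReal_re]
      linarith) ?_
  have hmem : {z : ℂ | M < z.re} ∈ 𝓝 (((M + 1 : ℝ) : ℂ)) := by
    refine (isOpen_lt continuous_const Complex.continuous_re).mem_nhds ?_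
    rw [Set.mem_ofPred_eq, Complex.ofReal_re]
    linarith
  filter_upwards [hmem] with z hz
  simp only [hM, max_lt_iff] at hz
  obtain ⟨p, hp⟩ := exists_hasSumAt_of_re_lt lam hs hz.2.1
  rw [hσ z hz.2.2 hz.1.1 p hp, hτ z hz.2.2 hz.1.2 p hp]

/-- The bounded holomorphic extension of `D` (its restriction to `Re > 0` is unique). -/
def boundedExtension {lam : Frequency} (D : Dext lam) : ℂ → ℂ :=
  D.2.2.choose

/-- The norm `‖D‖_∞ = sup_{Re s > 0} |f s|`, with `f` the bounded holomorphic extension of `D`. -/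
def supNorm {lam : Frequency} (D : Dext lam) : ℝ :=
  ⨆ s : {s : ℂ // 0 < s.re}, ‖boundedExtension D s‖

section Group

variable {G : Type*} [TopologicalSpace G] [CommGroup G]

/-! ### Dirichlet groups -/

/-- The continuous homomorphism `β : ℝ → G` makes `(G, β)` a `lam`-Dirichlet group: it has dense
range, and every character `t ↦ exp (-i (lam n) t)` of `ℝ` is of the form `γ ∘ β` for some
character `γ` of `G`. -/
structure IsDirichletGroup (lam : Frequency) (β : Multiplicative ℝ →ₜ* G) : Prop where
  denseRange : DenseRange β
  exists_char : ∀ n, ∃ γ : PontryaginDual G, ∀ t : ℝ,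
    (γ (β (Multiplicative.ofAdd t)) : ℂ) = Complex.exp (-Complex.I * (lam.seq n : ℂ) * (t : ℂ))

/-- The (unique) character `h_{lam n}` of `G` that extends `t ↦ exp (-i (lam n) t)`. -/
def IsDirichletGroup.char {lam : Frequency} {β : Multiplicative ℝ →ₜ* G}
    (hβ : IsDirichletGroup lam β) (n : ℕ) : PontryaginDual G :=
  (hβ.exists_char n).choose

/-- The character extending a given character of `ℝ` is unique, because `β` has dense range. -/
lemma IsDirichletGroup.eq_char {lam : Frequency} {β : Multiplicative ℝ →ₜ* G}
    (hβ : IsDirichletGroup lam β) {n : ℕ} {γ : PontryaginDual G}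
    (hγ : ∀ t : ℝ, (γ (β (Multiplicative.ofAdd t)) : ℂ) =
      Complex.exp (-Complex.I * (lam.seq n : ℂ) * (t : ℂ))) : γ = hβ.char n := by
  have h : (γ : G → Circle) = hβ.char n :=
    hβ.denseRange.equalizer (map_continuous γ) (map_continuous (hβ.char n)) (funext fun t =>
      Circle.ext ((hγ t.toAdd).trans ((hβ.exists_char n).choose_spec t.toAdd).symm))
  exact DFunLike.coe_injective h

/-! ### Hardy spaces on compact abelian groups -/

variable [MeasurableSpace G] [BorelSpace G]

/-- The Fourier coefficient `∫ f(ω) conj(γ(ω)) dμ(ω)` of `f` at the character `γ`. -/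
def fourierTransform (μ : Measure G) (f : G → ℂ) (γ : PontryaginDual G) : ℂ :=
  ∫ ω, f ω * (starRingEnd ℂ) (γ ω : ℂ) ∂μ

lemma integrable_mul_conj_char (μ : Measure G) [IsFiniteMeasure μ] {p : ℝ≥0∞} [hp : Fact (1 ≤ p)]
    (f : Lp ℂ p μ) (γ : PontryaginDual G) :
    Integrable (fun ω => f ω * (starRingEnd ℂ) (γ ω : ℂ)) μ := by
  have hc : Continuous fun ω : G => (starRingEnd ℂ) (γ ω : ℂ) :=
    Complex.continuous_conj.comp (continuous_subtype_val.comp (map_continuous γ))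
  refine ((Lp.memLp f).integrable hp.out).mul_bdd (c := 1) hc.aestronglyMeasurable
    (Eventually.of_forall fun ω => ?_)
  rw [RCLike.norm_conj]
  exact (Circle.norm_coe (γ ω)).le

/-- The Hardy space `H_p^E(G)`: all `f ∈ L_p(G)` whose Fourier transform is supported in `E`. -/
def hardySpace (μ : Measure G) [IsFiniteMeasure μ] (p : ℝ≥0∞) [Fact (1 ≤ p)]
    (E : Set (PontryaginDual G)) : Submodule ℂ (Lp ℂ p μ) where
  carrier := {f | ∀ γ : PontryaginDual G, fourierTransform μ f γ ≠ 0 → γ ∈ E}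
  zero_mem' := by
    intro γ h
    refine absurd ?_ h
    rw [fourierTransform, integral_congr_ae (g := fun _ => (0 : ℂ)), integral_zero]
    filter_upwards [Lp.coeFn_zero ℂ p μ] with ω hω
    have hω' : ((0 : Lp ℂ p μ) : G → ℂ) ω = 0 := hω
    exact mul_eq_zero_of_left hω' _
  add_mem' := by
    intro f g hf hg γ h
    by_contra hγ
    refine h ?_
    have h1 : fourierTransform μ f γ = 0 := by_contra fun h' => hγ (hf γ h')
    have h2 : fourierTransform μ g γ = 0 := by_contra fun h' => hγ (hg γ h')
    have : fourierTransform μ (f + g : Lp ℂ p μ) γ =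
        fourierTransform μ f γ + fourierTransform μ g γ := by
      unfold fourierTransform
      rw [← integral_add (integrable_mul_conj_char μ f γ) (integrable_mul_conj_char μ g γ)]
      refine integral_congr_ae ?_
      filter_upwards [Lp.coeFn_add f g] with ω hω
      rw [hω, Pi.add_apply, add_mul]
    rw [this, h1, h2, add_zero]
  smul_mem' := by
    intro c f hf γ h
    refine hf γ fun h' => h ?_
    have : fourierTransform μ (c • f : Lp ℂ p μ) γ = c * fourierTransform μ f γ := by
      unfold fourierTransform
      rw [← integral_const_mul]
      refine integral_congr_ae ?_
      filter_upwards [Lp.coeFn_smul c f] with ω hω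
      rw [hω, Pi.smul_apply, smul_eq_mul, mul_assoc]
    rw [this, h', mul_zero]

/-- The Hardy space `H_∞^lam(G)` of a `lam`-Dirichlet group `(G, β)`. -/
def hardyInfty (μ : Measure G) [IsFiniteMeasure μ] {lam : Frequency}
    {β : Multiplicative ℝ →ₜ* G} (hβ : IsDirichletGroup lam β) : Submodule ℂ (Lp ℂ ∞ μ) :=
  hardySpace μ ∞ (Set.range hβ.char)

end Group

end GenDirichlet

end

noncomputable section

namespace GenDirichlet

/-! ### Decay of the remainder of a Dirichlet series -/

/-! Let `F` be the bounded extension of `D` and `S_N` the sum of its first `N` terms. Abel summation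
makes `F - S_N` of order `e^{-λ_N x}` on the positive real axis, far to the right. Since `F - S_N`
is bounded on the half-plane, Phragmén–Lindelöf extends this decay to all of `Re s > 0`
(`IsBoundedExtension.exists_norm_sub_partialSum_le`). For `x < λ_N` the product `(F - S_N) e^{xs}`
therefore decays exponentially to the right, and Cauchy's theorem bounds its integrals over vertical
segments uniformly in the height and in the abscissa `ε > 0`. Its means thus vanish even when `ε`
shrinks while the segment grows, so along the single sequence `ε_n = 1/(n+1)`, `T_n = n+1` the means
of `F(ε_n + it) e^{ixt}` tend to `a_k` if `x = λ_k`, and to `0` if `x` is no frequency.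

Part (2) is Bessel's inequality for these means; no group is needed.

For part (1), the ultrafilter limit of the means of `F(ε_n + it) g(β(t))` is a linear functional of
`g ∈ C(G)`. The orbit of `β` is equidistributed, so the functional is bounded by `‖D‖_∞ ∫ |g|`,
hence is integration against a unique `f ∈ L_∞(G)` with `‖f‖_∞ ≤ ‖D‖_∞`. Uniqueness makes `D ↦ f`
linear. A character of `G` restricts along `β` to some `e^{-ixt}`, so the Fourier coefficients of
`f` are the limits above; they have the right support and determine `D`, whence injectivity. -/

lemma norm_sum_mul_antitone_le {b : ℕ → ℂ} {c : ℕ → ℝ} {C : ℝ} (hc : Antitone c)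
    (hc0 : ∀ n, 0 ≤ c n) (hb : ∀ m, ‖∑ n ∈ Finset.range m, b n‖ ≤ C) (m : ℕ) :
    ‖∑ n ∈ Finset.range m, b n * c n‖ ≤ C * c 0 := by
  -- Abel summation: the weights `c m` and `c n - c (n + 1)` are nonnegative and add up to `c 0`.
  have key : ∑ n ∈ Finset.range m, b n * c n = (∑ n ∈ Finset.range m, b n) * c m +
      ∑ n ∈ Finset.range m, (∑ k ∈ Finset.range (n + 1), b k) * ((c n - c (n + 1) : ℝ) : ℂ) := by
    induction m with
    | zero => simp
    | succ m ih =>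
      simp only [Finset.sum_range_succ] at ih ⊢
      rw [ih]
      push_cast
      ring
  have hbd : ∀ m n, 0 ≤ c n → ‖(∑ k ∈ Finset.range m, b k) * (c n : ℂ)‖ ≤ C * c n := by
    intro m n h
    rw [norm_mul, Complex.norm_real, Real.norm_of_nonneg h]
    exact mul_le_mul_of_nonneg_right (hb m) h
  rw [key]
  calc _ ≤ C * c m + ∑ n ∈ Finset.range m, C * (c n - c (n + 1)) := by
        refine (norm_add_le _ _).trans (add_le_add (hbd m m (hc0 m)) ?_)
        refine norm_sum_le_of_le _ fun n _ => ?_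
        have h : 0 ≤ c n - c (n + 1) := sub_nonneg.mpr (hc n.le_succ)
        rw [norm_mul, Complex.norm_real, Real.norm_of_nonneg h]
        exact mul_le_mul_of_nonneg_right (hb _) h
    _ = C * c 0 := by
        rw [← Finset.mul_sum, Finset.sum_range_sub']
        ring

/-- The tail at `x` is the tail at `x₀` damped by the decreasing weights `e^{-λ_{N+n}(x - x₀)}`, the
first of which gives the decay. Real points suffice, because Phragmén–Lindelöf asks for a bound only
on the real axis. -/
lemma exists_norm_sub_partialSum_le_of_real (lam : Frequency) {a : ℕ → ℂ} {x₀ : ℝ} {l₀ : ℂ}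
    (h : HasSumAt lam a x₀ l₀) (N : ℕ) : ∃ C : ℝ, ∀ x : ℝ, x₀ ≤ x → ∀ l : ℂ,
      HasSumAt lam a x l → ‖l - partialSum lam a x N‖ ≤ C * Real.exp (-lam.seq N * x) := by
  obtain ⟨B, hB⟩ := (Metric.isBounded_range_of_tendsto _ h).exists_norm_le
  refine ⟨2 * B * Real.exp (lam.seq N * x₀), fun x hx l hl => ?_⟩
  have hlim : Tendsto (fun m => partialSum lam a x (m + N) - partialSum lam a x N) atTop
      (𝓝 (l - partialSum lam a x N)) := ((tendsto_add_atTop_iff_nat N).mpr hl).sub_const _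
  refine le_of_tendsto hlim.norm (Eventually.of_forall fun m => ?_)
  have hsub : ∀ (y : ℂ) (m : ℕ), partialSum lam a y (m + N) - partialSum lam a y N =
      ∑ n ∈ Finset.range m, a (N + n) * Complex.exp (-(lam.seq (N + n) : ℂ) * y) := by
    intro y m
    rw [add_comm m N, partialSum, partialSum, Finset.sum_range_add, add_sub_cancel_left]
  have hmain := norm_sum_mul_antitone_le
    (b := fun n => a (N + n) * Complex.exp (-(lam.seq (N + n) : ℂ) * x₀))
    (c := fun n => Real.exp (-lam.seq (N + n) * (x - x₀))) (C := 2 * B)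
    (fun m n hmn => by
      have := lam.strictMono.monotone (Nat.add_le_add_left hmn N)
      have h2 : 0 ≤ x - x₀ := by linarith
      simp only [Real.exp_le_exp]
      nlinarith)
    (fun n => (Real.exp_pos _).le)
    (fun m => by
      rw [← hsub]
      have h1 := hB _ ⟨m + N, rfl⟩
      have h2 := hB _ ⟨N, rfl⟩
      exact (norm_sub_le _ _).trans (by linarith)) m
  rw [hsub]
  refine (le_of_eq ?_).trans (hmain.trans (le_of_eq ?_))
  · congr 1
    refine Finset.sum_congr rfl fun n _ => ?_
    rw [mul_assoc, Complex.ofReal_exp, ← Complex.exp_add]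
    congr 2
    push_cast
    ring
  · rw [mul_assoc (2 * B), ← Real.exp_add, add_zero]
    congr 2
    ring

lemma differentiable_partialSum (lam : Frequency) (a : ℕ → ℂ) (N : ℕ) :
    Differentiable ℂ fun s => partialSum lam a s N := by
  unfold partialSum
  fun_prop

lemma norm_partialSum_le (lam : Frequency) (a : ℕ → ℂ) (N : ℕ) {s : ℂ} (hs : 0 ≤ s.re) :
    ‖partialSum lam a s N‖ ≤ ∑ n ∈ Finset.range N, ‖a n‖ := by
  refine norm_sum_le_of_le _ fun n _ => ?_
  rw [norm_mul, Complex.norm_exp]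
  refine mul_le_of_le_one_right (norm_nonneg _) (Real.exp_le_one_iff.mpr ?_)
  have := mul_nonneg (lam.nonneg n) hs
  simpa using this

/-- The remainder of a Dirichlet series with bounded extension decays exponentially. -/
lemma IsBoundedExtension.exists_norm_sub_partialSum_le {lam : Frequency} {a : ℕ → ℂ} {f : ℂ → ℂ}
    (hf : IsBoundedExtension lam a f) (ha : ∃ s l : ℂ, HasSumAt lam a s l) (N : ℕ) :
    ∃ C : ℝ, ∀ s : ℂ, 0 < s.re →
      ‖f s - partialSum lam a s N‖ ≤ C * Real.exp (-lam.seq N * s.re) := by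
  obtain ⟨M, hM⟩ := hf.bounded
  obtain ⟨σ, hσ⟩ := hf.extend
  obtain ⟨s₀, l₀, hs₀⟩ := ha
  set B : ℝ := M + ∑ n ∈ Finset.range N, ‖a n‖ with hBdef
  have hB : ∀ s : ℂ, 0 < s.re → ‖f s - partialSum lam a s N‖ ≤ B := fun s hs =>
    (norm_sub_le _ _).trans (add_le_add (hM s hs) (norm_partialSum_le lam a N hs.le))
  have hB0 : 0 ≤ B := (norm_nonneg _).trans (hB 1 (by simp))
  have hN := lam.nonneg N
  obtain ⟨x₀, hx₀s, hx₀σ, hx₀⟩ : ∃ x₀ : ℝ, s₀.re < x₀ ∧ σ < x₀ ∧ 0 < x₀ :=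
    ⟨max s₀.re (max σ 0) + 1, by linarith [le_max_left s₀.re (max σ 0)],
      by linarith [le_max_right s₀.re (max σ 0), le_max_left σ 0],
      by linarith [le_max_right s₀.re (max σ 0), le_max_right σ 0]⟩
  obtain ⟨p₀, hp₀⟩ := exists_hasSumAt_of_re_lt lam hs₀ (s := (x₀ : ℂ)) (by simpa using hx₀s)
  obtain ⟨K, hK⟩ := exists_norm_sub_partialSum_le_of_real lam hp₀ N
  have hreal : ∀ x : ℝ, x₀ ≤ x →
      ‖f x - partialSum lam a x N‖ ≤ K * Real.exp (-lam.seq N * x) := by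
    intro x hx
    obtain ⟨p, hp⟩ := exists_hasSumAt_of_re_lt lam hs₀ (s := (x : ℂ)) (by
      simpa using hx₀s.trans_le hx)
    rw [hσ x (by simpa using hx₀.trans_le hx) (by simpa using hx₀σ.trans_le hx) p hp]
    exact hK x hx p hp
  -- The shift by `1` makes `Q` holomorphic across the imaginary axis. A uniform bound for `Q` is
  -- the desired decay on `Re s ≥ 1`.
  set Q : ℂ → ℂ := fun z => Complex.exp (lam.seq N * (z + 1)) *
    (f (z + 1) - partialSum lam a (z + 1) N) with hQ
  have hQnorm : ∀ z, ‖Q z‖ = Real.exp (lam.seq N * (z.re + 1)) *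
      ‖f (z + 1) - partialSum lam a (z + 1) N‖ := by
    intro z
    simp [hQ, Complex.norm_exp]
  have hdiff : DiffContOnCl ℂ Q {z | 0 < z.re} := by
    have hd : DifferentiableOn ℂ Q {z : ℂ | -1 < z.re} := by
      have h1 : DifferentiableOn ℂ (fun z : ℂ => f (z + 1)) {z : ℂ | -1 < z.re} := by
        refine hf.holomorphic.comp (by fun_prop) fun z hz => ?_
        have hz' : -1 < z.re := hz
        change 0 < (z + 1).re
        simp only [Complex.add_re, Complex.one_re]
        linarith
      have h2 : Differentiable ℂ fun z : ℂ => partialSum lam a (z + 1) N :=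
        (differentiable_partialSum lam a N).comp (by fun_prop)
      have h3 : Differentiable ℂ fun z : ℂ => Complex.exp (lam.seq N * (z + 1)) := by fun_prop
      exact h3.differentiableOn.mul (h1.sub h2.differentiableOn)
    refine DifferentiableOn.diffContOnCl (hd.mono ?_)
    refine (closure_minimal (t := {z : ℂ | 0 ≤ z.re}) (fun z (hz : 0 < z.re) => hz.le)
      (isClosed_le continuous_const Complex.continuous_re)).trans fun z hz => ?_
    have hz' : 0 ≤ z.re := hz
    change -1 < z.re
    linarith
  have hPL : ∀ z : ℂ, 0 ≤ z.re → ‖Q z‖ ≤ B * Real.exp (lam.seq N) := by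
    intro z hz
    -- `Q` has exponential type at most `λ_N` (order `1 < 2`), is bounded on the positive real axis
    -- by Abel summation, and is at most `B e^{λ_N}` on the imaginary axis.
    refine PhragmenLindelof.right_half_plane_of_bounded_on_real hdiff
      ⟨1, one_lt_two, lam.seq N, ?_⟩ ?_ ?_ hz
    · refine Asymptotics.IsBigO.of_bound (B * Real.exp (lam.seq N)) ?_
      refine eventually_inf_principal.mpr (Eventually.of_forall fun z hz => ?_)
      have hz' : 0 < z.re := hz
      rw [hQnorm, Real.rpow_one, Real.norm_of_nonneg (Real.exp_pos _).le, mul_assoc,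
        ← Real.exp_add, mul_comm]
      refine mul_le_mul (hB _ (by simp; linarith)) (Real.exp_le_exp.mpr ?_)
        (Real.exp_pos _).le hB0
      nlinarith [Complex.re_le_norm z]
    · refine ⟨K, ?_⟩
      rw [eventually_map]
      filter_upwards [eventually_ge_atTop x₀] with x hx
      rw [hQnorm]
      have h1 := hreal (x + 1) (by linarith)
      push_cast at h1
      rw [Complex.ofReal_re]
      calc _ ≤ Real.exp (lam.seq N * (x + 1)) * (K * Real.exp (-lam.seq N * (x + 1))) := by
            gcongr
        _ = K := by
            rw [mul_left_comm, ← Real.exp_add]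
            simp
    · intro x
      rw [hQnorm, mul_comm]
      refine mul_le_mul (hB _ (by simp)) (Real.exp_le_exp.mpr (by simp))
        (Real.exp_pos _).le hB0
  refine ⟨B * Real.exp (lam.seq N), fun s hs => ?_⟩
  -- For `Re s ≤ 1` the trivial bound `B` suffices, since `e^{λ_N (1 - Re s)} ≥ 1`.
  rcases le_total s.re 1 with h1 | h1
  · refine (hB s hs).trans ?_
    rw [mul_assoc, ← Real.exp_add]
    refine le_mul_of_one_le_right hB0 (Real.one_le_exp ?_)
    nlinarith
  · have h2 := hPL (s - 1) (by simpa using h1)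
    rw [hQnorm] at h2
    simp only [Complex.sub_re, Complex.one_re, sub_add_cancel] at h2
    rw [neg_mul, Real.exp_neg, ← div_eq_mul_inv, le_div_iff₀ (Real.exp_pos _), mul_comm]
    exact h2

/-- Vertical integrals of a function that decays exponentially to the right are bounded. -/
lemma norm_integral_vertical_le {g : ℂ → ℂ} {C δ ε T : ℝ}
    (hg : DifferentiableOn ℂ g {s : ℂ | 0 < s.re}) (hδ : 0 < δ) (hε : 0 < ε) (hT : 0 ≤ T)
    (hC : ∀ s : ℂ, 0 < s.re → ‖g s‖ ≤ C * Real.exp (-δ * s.re)) :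
    ‖∫ t in (-T)..T, g (ε + t * Complex.I)‖ ≤ 2 * C / δ := by
  have hC0 : 0 ≤ C := by
    have := (norm_nonneg _).trans (hC 1 (by simp))
    exact nonneg_of_mul_nonneg_left this (Real.exp_pos _)
  have hhor : ∀ κ, ε ≤ κ → ∀ y : ℝ, ‖∫ x in ε..κ, g (x + y * Complex.I)‖ ≤ C / δ := by
    intro κ hκ y
    have h1 : ∀ x ∈ Set.Ioc ε κ, ‖g (x + y * Complex.I)‖ ≤ C * Real.exp (-δ * x) := by
      intro x hx
      have := hC (x + y * Complex.I) (by simpa using hε.trans hx.1)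
      simpa using this
    refine (intervalIntegral.norm_integral_le_of_norm_le hκ
      (Eventually.of_forall h1) (Continuous.intervalIntegrable (by fun_prop) _ _)).trans ?_
    rw [intervalIntegral.integral_const_mul,
      intervalIntegral.integral_comp_mul_left (fun t => Real.exp t) (neg_ne_zero.mpr hδ.ne'),
      integral_exp, smul_eq_mul, div_eq_mul_inv]
    refine mul_le_mul_of_nonneg_left ?_ hC0
    rw [inv_neg, neg_mul, ← mul_neg, neg_sub]
    refine mul_le_of_le_one_right (inv_nonneg.mpr hδ.le) ?_
    have h2 : Real.exp (-δ * ε) ≤ 1 := Real.exp_le_one_iff.mpr (by nlinarith)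
    linarith [Real.exp_pos (-δ * κ)]
  have hver : ∀ κ, ε ≤ κ → ‖∫ t in (-T)..T, g (κ + t * Complex.I)‖ ≤
      C * Real.exp (-δ * κ) * (2 * T) := by
    intro κ hκ
    refine (intervalIntegral.norm_integral_le_of_norm_le_const (C := C * Real.exp (-δ * κ))
      fun t _ => ?_).trans (le_of_eq ?_)
    · simpa using hC (κ + t * Complex.I) (by simpa using hε.trans_le hκ)
    · rw [abs_of_nonneg (by linarith)]
      ring
  -- Move the contour to `Re = κ`: each horizontal side costs at most `C / δ`, whatever `T` and `ε`
  -- are, and the far side vanishes as `κ → ∞`.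
  have hall : ∀ κ, ε ≤ κ → ‖∫ t in (-T)..T, g (ε + t * Complex.I)‖ ≤
      2 * C / δ + C * Real.exp (-δ * κ) * (2 * T) := by
    intro κ hκ
    have hrect := Complex.integral_boundary_rect_eq_zero_of_differentiableOn g
      (ε + (-T : ℝ) * Complex.I) (κ + T * Complex.I) (hg.mono fun z hz => by
        have := hz.1
        simp only [Set.mem_preimage, Complex.add_re, Complex.ofReal_re, Complex.mul_re,
          Complex.I_re, Complex.I_im, Complex.ofReal_im, mul_zero, mul_one, sub_self, add_zero,
          Set.uIcc_of_le hκ] at this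
        exact hε.trans_le this.1)
    simp only [Complex.add_re, Complex.ofReal_re, Complex.mul_re, Complex.I_re, Complex.I_im,
      Complex.ofReal_im, mul_zero, mul_one, sub_self, add_zero, Complex.add_im, Complex.mul_im,
      zero_add, smul_eq_mul] at hrect
    have hI : Complex.I * (∫ t in (-T)..T, g (ε + t * Complex.I)) =
        (∫ x in ε..κ, g (x + (-T : ℝ) * Complex.I)) - (∫ x in ε..κ, g (x + T * Complex.I)) +
        Complex.I * (∫ t in (-T)..T, g (κ + t * Complex.I)) := by
      rw [eq_comm, ← sub_eq_zero]
      exact hrect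
    have hn := congrArg norm hI
    rw [norm_mul, Complex.norm_I, one_mul] at hn
    rw [hn]
    refine (norm_add_le _ _).trans ?_
    rw [norm_mul, Complex.norm_I, one_mul]
    refine add_le_add ((norm_sub_le _ _).trans ?_) (hver κ hκ)
    have h1 := hhor κ hκ (-T)
    have h2 := hhor κ hκ T
    rw [two_mul, add_div]
    exact add_le_add h1 h2
  have hlim : Tendsto (fun κ : ℝ => 2 * C / δ + C * Real.exp (-δ * κ) * (2 * T)) atTop
      (𝓝 (2 * C / δ + C * 0 * (2 * T))) := by
    refine (((?_ : Tendsto _ _ _).const_mul C).mul_const _).const_add _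
    refine (Real.tendsto_exp_neg_atTop_nhds_zero.comp
      (tendsto_id.const_mul_atTop hδ)).congr fun κ => ?_
    simp
  have := ge_of_tendsto hlim (by
    filter_upwards [eventually_ge_atTop ε] with κ hκ using hall κ hκ)
  simpa using this

/-! ### Means over symmetric intervals -/

/-- The mean of `h` over the interval `[-(n + 1), n + 1]`. -/
def symmMean (n : ℕ) (h : ℝ → ℂ) : ℂ :=
  (2 * ((n : ℂ) + 1))⁻¹ * ∫ t in (-((n : ℝ) + 1))..((n : ℝ) + 1), h t

lemma symmMean_add (n : ℕ) {g h : ℝ → ℂ} (hg : Continuous g) (hh : Continuous h) :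
    symmMean n (fun t => g t + h t) = symmMean n g + symmMean n h := by
  rw [symmMean, intervalIntegral.integral_add (hg.intervalIntegrable _ _)
    (hh.intervalIntegrable _ _), mul_add]
  rfl

lemma symmMean_const_mul (n : ℕ) (c : ℂ) (h : ℝ → ℂ) :
    symmMean n (fun t => c * h t) = c * symmMean n h := by
  rw [symmMean, intervalIntegral.integral_const_mul, mul_left_comm]
  rfl

lemma symmMean_sum (n : ℕ) {ι : Type*} (s : Finset ι) {g : ι → ℝ → ℂ}
    (hg : ∀ i, Continuous (g i)) :
    symmMean n (fun t => ∑ i ∈ s, g i t) = ∑ i ∈ s, symmMean n (g i) := by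
  rw [symmMean, intervalIntegral.integral_finsetSum
    fun i _ => (hg i).intervalIntegrable _ _, Finset.mul_sum]
  rfl

lemma symmMean_const (n : ℕ) (c : ℂ) : symmMean n (fun _ => c) = c := by
  have h : (n : ℂ) + 1 ≠ 0 := Nat.cast_add_one_ne_zero n
  rw [symmMean, intervalIntegral.integral_const, Complex.real_smul]
  push_cast
  field_simp
  ring

lemma symmMean_ofReal (n : ℕ) (h : ℝ → ℝ) : symmMean n (fun t => (h t : ℂ)) =
    (((2 * ((n : ℝ) + 1))⁻¹ * ∫ t in (-((n : ℝ) + 1))..((n : ℝ) + 1), h t : ℝ) : ℂ) := by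
  rw [symmMean, intervalIntegral.integral_ofReal]
  push_cast
  rfl

lemma norm_symmMean_le_re (n : ℕ) {h : ℝ → ℂ} {g : ℝ → ℝ} (hg : Continuous g)
    (hgh : ∀ t, ‖h t‖ ≤ g t) : ‖symmMean n h‖ ≤ (symmMean n fun t => (g t : ℂ)).re := by
  have hn : (0 : ℝ) ≤ n + 1 := by positivity
  have hnorm : ‖(2 * ((n : ℂ) + 1))⁻¹‖ = (2 * ((n : ℝ) + 1))⁻¹ := by
    rw [norm_inv, norm_mul, Complex.norm_ofNat]
    congr 2
    exact_mod_cast Complex.norm_natCast (n + 1)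
  rw [symmMean_ofReal, Complex.ofReal_re, symmMean, norm_mul, hnorm]
  gcongr
  exact intervalIntegral.norm_integral_le_of_norm_le (by linarith)
    (Eventually.of_forall fun t _ => hgh t) (hg.intervalIntegrable _ _)

lemma norm_symmMean_le (n : ℕ) {h : ℝ → ℂ} {M : ℝ} (hM : ∀ t, ‖h t‖ ≤ M) :
    ‖symmMean n h‖ ≤ M := by
  have := norm_symmMean_le_re n (g := fun _ => M) continuous_const hM
  rwa [symmMean_const, Complex.ofReal_re] at this

lemma re_symmMean_le (n : ℕ) {h : ℝ → ℂ} {M : ℝ} (hh : Continuous h) (hM : ∀ t, (h t).re ≤ M) :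
    (symmMean n h).re ≤ M := by
  have hn : (0 : ℝ) < n + 1 := by positivity
  have h1 : (∫ t in (-((n : ℝ) + 1))..((n : ℝ) + 1), h t).re =
      ∫ t in (-((n : ℝ) + 1))..((n : ℝ) + 1), (h t).re :=
    (Complex.reCLM.intervalIntegral_comp_comm (hh.intervalIntegrable _ _)).symm
  have h2 : (2 * ((n : ℂ) + 1))⁻¹ = (((2 * ((n : ℝ) + 1))⁻¹ : ℝ) : ℂ) := by push_cast; rfl
  rw [symmMean, h2, Complex.re_ofReal_mul, h1, inv_mul_le_iff₀ (by positivity)]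
  refine (intervalIntegral.integral_mono_on (by linarith)
    ((Complex.continuous_re.comp hh).intervalIntegrable _ _)
    ((continuous_const (y := M)).intervalIntegrable _ _) fun t _ => hM t).trans (le_of_eq ?_)
  rw [intervalIntegral.integral_const, smul_eq_mul]
  ring

/-- The integrand may depend on `n`; this lets the vertical line approach the imaginary axis while
the interval grows. -/
lemma tendsto_symmMean_zero_of_integral_le {h : ℕ → ℝ → ℂ} {K : ℝ}
    (hK : ∀ n : ℕ, ‖∫ t in (-((n : ℝ) + 1))..((n : ℝ) + 1), h n t‖ ≤ K) :
    Tendsto (fun n => symmMean n (h n)) atTop (𝓝 0) := by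
  have h1 : Tendsto (fun n : ℕ => (K / 2) * (1 / ((n : ℝ) + 1))) atTop (𝓝 ((K / 2) * 0)) :=
    tendsto_one_div_add_atTop_nhds_zero_nat.const_mul _
  rw [mul_zero] at h1
  refine squeeze_zero_norm (fun n => ?_) h1
  have hnorm : ‖(2 * ((n : ℂ) + 1))⁻¹‖ = (2 * ((n : ℝ) + 1))⁻¹ := by
    rw [norm_inv, norm_mul, Complex.norm_ofNat]
    congr 2
    exact_mod_cast Complex.norm_natCast (n + 1)
  rw [symmMean, norm_mul, hnorm]
  refine (mul_le_mul_of_nonneg_left (hK n) (by positivity)).trans (le_of_eq ?_)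
  field_simp

/-- Orthogonality of exponentials: for `μ ≠ 0` every integral over an interval is at most `2 / |μ|`.
-/
lemma tendsto_symmMean_exp (μ : ℝ) :
    Tendsto (fun n => symmMean n fun t => Complex.exp (Complex.I * μ * t)) atTop
      (𝓝 (if μ = 0 then 1 else 0)) := by
  split_ifs with hμ
  · subst hμ
    simp [symmMean_const]
  · have hne : Complex.I * (μ : ℂ) ≠ 0 := by simp [hμ]
    refine tendsto_symmMean_zero_of_integral_le (K := 2 / |μ|) fun n => ?_
    rw [integral_exp_mul_complex hne, norm_div, norm_mul, Complex.norm_I, one_mul,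
      Complex.norm_real, Real.norm_eq_abs]
    gcongr
    refine (norm_sub_le _ _).trans ?_
    simp [Complex.norm_exp]
    norm_num

/-! ### Bohr coefficients and Bessel's inequality. -/

lemma IsBoundedExtension.continuous_vertical {lam : Frequency} {a : ℕ → ℂ} {f : ℂ → ℂ}
    (hf : IsBoundedExtension lam a f) {ε : ℝ} (hε : 0 < ε) :
    Continuous fun t : ℝ => f (ε + t * Complex.I) :=
  hf.holomorphic.continuousOn.comp_continuous (by fun_prop) fun t => by simpa using hε

/-- The Bohr coefficients of the bounded extension, computed along vertical lines that approach
the imaginary axis. -/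
lemma IsBoundedExtension.tendsto_symmMean {lam : Frequency} {a : ℕ → ℂ} {f : ℂ → ℂ}
    (hf : IsBoundedExtension lam a f) (ha : ∃ s l : ℂ, HasSumAt lam a s l) (x : ℝ) {N : ℕ}
    (hN : x < lam.seq N) :
    Tendsto (fun n : ℕ => symmMean n fun t =>
      f ((1 / ((n : ℝ) + 1) : ℝ) + t * Complex.I) * Complex.exp (Complex.I * x * t)) atTop
      (𝓝 (∑ k ∈ Finset.range N, if lam.seq k = x then a k else 0)) := by
  obtain ⟨C, hC⟩ := hf.exists_norm_sub_partialSum_le ha N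
  set ε : ℕ → ℝ := fun n => 1 / ((n : ℝ) + 1) with hε
  have hε0 : ∀ n, 0 < ε n := fun n => by positivity
  have hεlim : Tendsto ε atTop (𝓝 0) := tendsto_one_div_add_atTop_nhds_zero_nat
  -- On `Re = ε n` the factor `e^{xs}` is `e^{x ε_n} e^{ixt}`. It keeps the remainder decaying at
  -- rate `λ_N - x > 0`, and the surplus `e^{x ε_n}` tends to `1`.
  set g : ℂ → ℂ := fun s => (f s - partialSum lam a s N) * Complex.exp (x * s) with hg
  have hgdiff : DifferentiableOn ℂ g {s : ℂ | 0 < s.re} := by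
    have h3 : Differentiable ℂ fun z : ℂ => Complex.exp (x * z) := by fun_prop
    exact (hf.holomorphic.sub (differentiable_partialSum lam a N).differentiableOn).mul
      h3.differentiableOn
  have hgC : ∀ s : ℂ, 0 < s.re → ‖g s‖ ≤ C * Real.exp (-(lam.seq N - x) * s.re) := by
    intro s hs
    rw [hg, norm_mul, Complex.norm_exp, Complex.re_ofReal_mul]
    refine (mul_le_mul_of_nonneg_right (hC s hs) (Real.exp_pos _).le).trans (le_of_eq ?_)
    rw [mul_assoc, ← Real.exp_add]
    ring_nf
  have hgcont : ∀ n, Continuous fun t : ℝ => g (ε n + t * Complex.I) := fun n =>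
    hgdiff.continuousOn.comp_continuous (by fun_prop) fun t => by simpa using hε0 n
  have hrem := tendsto_symmMean_zero_of_integral_le
    (h := fun n (t : ℝ) => g (ε n + t * Complex.I)) fun n =>
    norm_integral_vertical_le hgdiff (sub_pos.mpr hN) (hε0 n) (by positivity) hgC
  have hexp : ∀ y : ℝ, Tendsto (fun n => Complex.exp (-y * ε n)) atTop (𝓝 1) := by
    intro y
    have h1 : Continuous fun u : ℝ => Complex.exp (-y * u) := by fun_prop
    have h2 := (h1.tendsto 0).comp hεlim
    simpa [Function.comp_def] using h2
  have heq : ∀ n, (symmMean n fun t =>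
      f (ε n + t * Complex.I) * Complex.exp (Complex.I * x * t)) =
      Complex.exp (-x * ε n) * symmMean n (fun t => g (ε n + t * Complex.I)) +
      ∑ k ∈ Finset.range N, a k * Complex.exp (-(lam.seq k) * ε n) *
        symmMean n (fun t => Complex.exp (Complex.I * (x - lam.seq k : ℝ) * t)) := by
    intro n
    rw [← symmMean_const_mul]
    simp_rw [← symmMean_const_mul]
    rw [← symmMean_sum _ _ fun k => by fun_prop, ← symmMean_add]
    · congr 1
      funext t
      have e1 : Complex.exp (-x * ε n) * g (ε n + t * Complex.I) =
          (f (ε n + t * Complex.I) - partialSum lam a (ε n + t * Complex.I) N) *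
          Complex.exp (Complex.I * x * t) := by
        rw [hg, mul_left_comm, ← Complex.exp_add]
        ring_nf
      have e2 : ∑ k ∈ Finset.range N, a k * Complex.exp (-(lam.seq k) * ε n) *
          Complex.exp (Complex.I * (x - lam.seq k : ℝ) * t) =
          partialSum lam a (ε n + t * Complex.I) N * Complex.exp (Complex.I * x * t) := by
        rw [partialSum, Finset.sum_mul]
        refine Finset.sum_congr rfl fun k _ => ?_
        rw [mul_assoc (a k), mul_assoc (a k), ← Complex.exp_add, ← Complex.exp_add]
        push_cast
        ring_nf
      rw [e1, e2]
      ring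
    · exact (hgcont n).const_mul _
    · fun_prop
  refine Tendsto.congr (fun n => (heq n).symm) ?_
  have hlim := ((hexp x).mul hrem).add (tendsto_finsetSum (Finset.range N) fun k _ =>
    ((hexp (lam.seq k)).const_mul (a k)).mul (tendsto_symmMean_exp (x - lam.seq k)))
  refine hlim.trans (le_of_eq ?_)
  congr 1
  simp only [mul_zero, zero_add, mul_one]
  refine Finset.sum_congr rfl fun k _ => ?_
  simp [sub_eq_zero, eq_comm (a := x)]

lemma IsBoundedExtension.tendsto_symmMean_seq {lam : Frequency} {a : ℕ → ℂ} {f : ℂ → ℂ}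
    (hf : IsBoundedExtension lam a f) (ha : ∃ s l : ℂ, HasSumAt lam a s l) (m : ℕ) :
    Tendsto (fun n : ℕ => symmMean n fun t => f ((1 / ((n : ℝ) + 1) : ℝ) + t * Complex.I) *
      Complex.exp (Complex.I * lam.seq m * t)) atTop (𝓝 (a m)) := by
  have h := hf.tendsto_symmMean ha (lam.seq m) (lam.strictMono m.lt_succ_self)
  simpa [lam.strictMono.injective.eq_iff] using h

lemma IsBoundedExtension.tendsto_symmMean_of_ne {lam : Frequency} {a : ℕ → ℂ} {f : ℂ → ℂ}
    (hf : IsBoundedExtension lam a f) (ha : ∃ s l : ℂ, HasSumAt lam a s l) {x : ℝ}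
    (hx : ∀ n, lam.seq n ≠ x) :
    Tendsto (fun n : ℕ => symmMean n fun t => f ((1 / ((n : ℝ) + 1) : ℝ) + t * Complex.I) *
      Complex.exp (Complex.I * x * t)) atTop (𝓝 0) := by
  obtain ⟨N, hN⟩ := (lam.tendsto_atTop.eventually_gt_atTop x).exists
  simpa [hx] using hf.tendsto_symmMean ha x hN

/-- Bessel's inequality for the Dirichlet coefficients. -/
lemma IsBoundedExtension.sum_norm_sq_le {lam : Frequency} {a : ℕ → ℂ} {f : ℂ → ℂ}
    (hf : IsBoundedExtension lam a f) (ha : ∃ s l : ℂ, HasSumAt lam a s l) {M : ℝ}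
    (hM : ∀ s : ℂ, 0 < s.re → ‖f s‖ ≤ M) (N : ℕ) :
    ∑ k ∈ Finset.range N, ‖a k‖ ^ 2 ≤ M ^ 2 := by
  set ε : ℕ → ℝ := fun n => 1 / ((n : ℝ) + 1) with hε
  have hε0 : ∀ n, 0 < ε n := fun n => by positivity
  set e : ℕ → ℝ → ℂ := fun k t => Complex.exp (Complex.I * lam.seq k * t) with he
  set p : ℝ → ℂ := fun t => ∑ k ∈ Finset.range N, a k * (starRingEnd ℂ) (e k t) with hp
  have hecont : ∀ k, Continuous (e k) := fun k => by fun_prop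
  have hpcont : Continuous p := by fun_prop
  obtain ⟨F, hF⟩ : ∃ F : ℕ → ℝ → ℂ, ∀ n t, F n t = f (ε n + t * Complex.I) := ⟨_, fun _ _ => rfl⟩
  have hFcont : ∀ n, Continuous (F n) := fun n =>
    (hf.continuous_vertical (hε0 n)).congr fun t => (hF n t).symm
  have hFmean : ∀ k, Tendsto (fun n => symmMean n fun t => F n t * e k t) atTop (𝓝 (a k)) := by
    intro k
    simp_rw [hF]
    exact hf.tendsto_symmMean_seq ha k
  have hconj : ∀ j k t, (starRingEnd ℂ) (e j t) * e k t =
      Complex.exp (Complex.I * (lam.seq k - lam.seq j : ℝ) * t) := by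
    intro j k t
    simp only [he, ← Complex.exp_conj, ← Complex.exp_add, map_mul, Complex.conj_I,
      Complex.conj_ofReal]
    push_cast
    ring_nf
  have hpmean : ∀ k ∈ Finset.range N,
      Tendsto (fun n => symmMean n fun t => p t * e k t) atTop (𝓝 (a k)) := by
    intro k hk
    have h1 : ∀ n, (symmMean n fun t => p t * e k t) = ∑ j ∈ Finset.range N,
        a j * symmMean n fun t => Complex.exp (Complex.I * (lam.seq k - lam.seq j : ℝ) * t) := by
      intro n
      simp_rw [← symmMean_const_mul]
      rw [← symmMean_sum _ _ fun j => by fun_prop]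
      simp_rw [hp, Finset.sum_mul, mul_assoc (a _), hconj]
    refine Tendsto.congr (fun n => (h1 n).symm) ?_
    refine (tendsto_finsetSum (Finset.range N) fun j _ =>
      (tendsto_symmMean_exp (lam.seq k - lam.seq j)).const_mul (a j)).trans (le_of_eq ?_)
    congr 1
    simp only [sub_eq_zero, lam.strictMono.injective.eq_iff, mul_ite, mul_one, mul_zero,
      Finset.sum_ite_eq, if_pos hk]
  -- `Re((2F - p) p̄) = |F|² - |F - p|² ≤ M²`, while the mean of the left side tends to `2∑|a_k|² -
  -- ∑|a_k|²`. This avoids computing the mean of `|F|²`.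
  have hmean : ∀ n, (symmMean n fun t =>
      (2 * F n t - p t) * (starRingEnd ℂ) (p t)) =
      ∑ k ∈ Finset.range N, (starRingEnd ℂ) (a k) *
        (2 * symmMean n (fun t => F n t * e k t) +
          (-1) * symmMean n fun t => p t * e k t) := by
    intro n
    simp_rw [← symmMean_const_mul]
    have h2 : ∀ k, (symmMean n fun t => 2 * (F n t * e k t)) +
        (symmMean n fun t => -1 * (p t * e k t)) =
        symmMean n fun t => 2 * (F n t * e k t) + -1 * (p t * e k t) :=
      fun k => (symmMean_add n (by fun_prop) (by fun_prop)).symm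
    simp_rw [h2, ← symmMean_const_mul]
    rw [← symmMean_sum _ _ fun j => by fun_prop]
    congr 1
    funext t
    simp only [hp, map_sum, map_mul, Complex.conj_conj]
    rw [Finset.mul_sum]
    refine Finset.sum_congr rfl fun k _ => ?_
    ring
  have hlim : Tendsto (fun n => symmMean n fun t =>
      (2 * F n t - p t) * (starRingEnd ℂ) (p t)) atTop
      (𝓝 (∑ k ∈ Finset.range N, (starRingEnd ℂ) (a k) * (2 * a k + (-1) * a k))) := by
    refine Tendsto.congr (fun n => (hmean n).symm) ?_
    exact tendsto_finsetSum _ fun k hk => (((hFmean k).const_mul 2).add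
      ((hpmean k hk).const_mul (-1))).const_mul _
  have hre := (Complex.continuous_re.tendsto _).comp hlim
  have hle := le_of_tendsto hre (b := M ^ 2) (Eventually.of_forall fun n => by
    refine re_symmMean_le n (by fun_prop) fun t => ?_
    have h1 := hM (ε n + t * Complex.I) (by simpa using hε0 n)
    rw [← hF] at h1
    set z := F n t
    have h2 : z.re ^ 2 + z.im ^ 2 ≤ M ^ 2 := by
      have h3 : ‖z‖ ^ 2 ≤ M ^ 2 := pow_le_pow_left₀ (norm_nonneg _) h1 2
      rwa [Complex.sq_norm, Complex.normSq_apply, ← sq, ← sq] at h3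
    simp only [Complex.mul_re, Complex.sub_re, Complex.sub_im, Complex.conj_re, Complex.conj_im,
      Complex.mul_im, Complex.re_ofNat, Complex.im_ofNat]
    nlinarith [sq_nonneg (z.re - (p t).re), sq_nonneg (z.im - (p t).im)])
  refine (le_of_eq ?_).trans hle
  rw [Complex.re_sum]
  refine Finset.sum_congr rfl fun k _ => ?_
  rw [Complex.sq_norm, Complex.normSq_apply]
  simp
  ring

/-! ### Continuous characters of the real line -/

/-- Integrating the functional equation writes `χ` as a difference of values of its antiderivative,
up to a constant factor. So `χ` is differentiable and solves `χ' = c χ`; modulus one forces `c` to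
be imaginary. -/
lemma exists_eq_exp_of_map_add {χ : ℝ → ℂ} (hχ : Continuous χ)
    (hadd : ∀ s t, χ (s + t) = χ s * χ t) (hnorm : ∀ t, ‖χ t‖ = 1) :
    ∃ x : ℝ, ∀ t : ℝ, χ t = Complex.exp (-Complex.I * x * t) := by
  have hne : ∀ t, χ t ≠ 0 := fun t h => by simpa [h] using hnorm t
  have hzero : χ 0 = 1 := by
    have := hadd 0 0
    rw [add_zero] at this
    exact (mul_left_cancel₀ (hne 0) (by rw [← this, mul_one])).symm
  set Φ : ℝ → ℂ := fun x => ∫ t in (0 : ℝ)..x, χ t with hΦ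
  have hΦd : ∀ x, HasDerivAt Φ (χ x) x := fun x => hχ.integral_hasStrictDerivAt 0 x |>.hasDerivAt
  -- `Φ` cannot vanish identically, since `Φ'(0) = χ 0 = 1`.
  obtain ⟨b, hb⟩ : ∃ b, Φ b ≠ 0 := by
    by_contra! h
    have h1 : Φ = fun _ => 0 := funext h
    have h2 := hΦd 0
    rw [h1, hzero] at h2
    exact one_ne_zero (h2.unique (hasDerivAt_const 0 0))
  have hshift : ∀ x, Φ (x + b) - Φ x = χ x * Φ b := by
    intro x
    simp only [hΦ]
    rw [intervalIntegral.integral_interval_sub_left (hχ.intervalIntegrable _ _)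
      (hχ.intervalIntegrable _ _), ← intervalIntegral.integral_const_mul]
    simp_rw [← hadd]
    rw [intervalIntegral.integral_comp_add_left (fun t => χ t) x, add_zero]
  have hform : χ = fun x => (Φ (x + b) - Φ x) / Φ b := by
    funext x
    rw [hshift, mul_div_cancel_right₀ _ hb]
  set c : ℂ := (χ b - 1) / Φ b with hc
  have hder : ∀ x, HasDerivAt χ (c * χ x) x := by
    intro x
    have h1 : HasDerivAt (fun x => (Φ (x + b) - Φ x) / Φ b) ((χ (x + b) - χ x) / Φ b) x :=
      (((hΦd (x + b)).comp_add_const x b).sub (hΦd x)).div_const _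
    rw [← hform] at h1
    convert h1 using 1
    rw [hc, hadd]
    field_simp
  have hexp : ∀ t : ℝ, χ t = Complex.exp (c * t) := by
    have hd : ∀ t : ℝ, HasDerivAt (fun t : ℝ => χ t * Complex.exp (-c * t)) 0 t := by
      intro t
      have h1 : HasDerivAt (fun t : ℝ => -c * (t : ℂ)) (-c) t := by
        simpa using (Complex.ofRealCLM.hasDerivAt (x := t)).const_mul (-c)
      refine ((hder t).mul h1.cexp).congr_deriv ?_
      ring
    intro t
    have h2 := is_const_of_deriv_eq_zero (fun t => (hd t).differentiableAt)
      (fun t => (hd t).deriv) t 0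
    simp only [hzero, Complex.ofReal_zero, mul_zero, Complex.exp_zero, mul_one] at h2
    rw [neg_mul, Complex.exp_neg, ← div_eq_mul_inv, div_eq_one_iff_eq (Complex.exp_ne_zero _)]
      at h2
    exact h2
  have hcre : c.re = 0 := by
    have := hnorm 1
    rw [hexp, Complex.norm_exp, Real.exp_eq_one_iff] at this
    simpa using this
  refine ⟨-c.im, fun t => ?_⟩
  rw [hexp]
  congr 2
  apply Complex.ext <;> simp [hcre]

/-! ### Functionals on continuous functions that are bounded in the `L¹` norm -/

section Representation

variable {X : Type*} [MeasurableSpace X]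

lemma integral_norm_le_norm_Lp_two (μ : Measure X) [IsProbabilityMeasure μ] (h : Lp ℂ 2 μ) :
    ∫ ω, ‖h ω‖ ∂μ ≤ ‖h‖ := by
  rw [integral_norm_eq_lintegral_enorm (Lp.aestronglyMeasurable h), ← eLpNorm_one_eq_lintegral_enorm,
    Lp.norm_def]
  exact ENNReal.toReal_mono (Lp.eLpNorm_ne_top h)
    (eLpNorm_le_eLpNorm_of_exponent_le one_le_two (Lp.aestronglyMeasurable h))

/-- On a probability space the `L¹` norm is 1-Lipschitz in the `L²` norm; this carries `L¹` bounds
from the dense continuous functions to all of `L²`. -/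
lemma continuous_integral_norm_Lp_two (μ : Measure X) [IsProbabilityMeasure μ] :
    Continuous fun h : Lp ℂ 2 μ => ∫ ω, ‖h ω‖ ∂μ := by
  have hint : ∀ h : Lp ℂ 2 μ, Integrable (fun ω => ‖h ω‖) μ := fun h =>
    ((Lp.memLp h).integrable one_le_two).norm
  refine (LipschitzWith.of_le_add fun h k => ?_).continuous
  rw [dist_eq_norm]
  refine le_trans ?_ (add_le_add_right (integral_norm_le_norm_Lp_two μ (h - k)) _)
  rw [← integral_add (hint k) (hint _)]
  refine integral_mono_ae (hint h) ((hint k).add (hint _)) ?_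
  filter_upwards [Lp.coeFn_sub h k] with ω hω
  rw [hω, Pi.sub_apply]
  exact norm_le_norm_add_norm_sub' (h ω) (k ω)

/-- Test against `k = f 1_A` with `A = {|f| > M}`: then `∫_A |f| (|f| - M) ≤ 0` although the
integrand is positive on `A`, so `A` is null. -/
lemma ae_norm_le_of_norm_inner_le {μ : Measure X} [IsProbabilityMeasure μ] {f : Lp ℂ 2 μ} {M : ℝ}
    (hM : 0 ≤ M) (h : ∀ k : Lp ℂ 2 μ, ‖inner ℂ f k‖ ≤ M * ∫ ω, ‖k ω‖ ∂μ) :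
    ∀ᵐ ω ∂μ, ‖f ω‖ ≤ M := by
  set A : Set X := {ω | M < ‖f ω‖} with hA
  have hAm : MeasurableSet A :=
    measurableSet_lt measurable_const (Lp.stronglyMeasurable f).norm.measurable
  have hind := (Lp.memLp f).indicator hAm
  set k : Lp ℂ 2 μ := hind.toLp _ with hk
  have hkae : k =ᵐ[μ] A.indicator f := hind.coeFn_toLp
  have hsq : Integrable (fun ω => ‖f ω‖ ^ 2) μ := (Lp.memLp f).integrable_norm_pow two_ne_zero
  have hone : Integrable (fun ω => ‖f ω‖) μ := ((Lp.memLp f).integrable one_le_two).norm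
  have h1 : inner ℂ f k = ((∫ ω, A.indicator (fun ω => ‖f ω‖ ^ 2) ω ∂μ : ℝ) : ℂ) := by
    rw [L2.inner_def, ← integral_complex_ofReal]
    refine integral_congr_ae ?_
    filter_upwards [hkae] with ω hω
    rw [hω]
    by_cases hωA : ω ∈ A
    · rw [Set.indicator_of_mem hωA, Set.indicator_of_mem hωA, inner_self_eq_norm_sq_to_K]
      simp
    · simp [hωA]
  have h2 : ∫ ω, ‖k ω‖ ∂μ = ∫ ω, A.indicator (fun ω => ‖f ω‖) ω ∂μ := by
    refine integral_congr_ae ?_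
    filter_upwards [hkae] with ω hω
    rw [hω, norm_indicator_eq_indicator_norm]
  have h3 := h k
  rw [h1, h2, Complex.norm_real] at h3
  have h4 : ∫ ω, A.indicator (fun ω => ‖f ω‖ ^ 2 - M * ‖f ω‖) ω ∂μ ≤ 0 := by
    rw [integral_indicator hAm, integral_sub hsq.integrableOn (hone.const_mul M).integrableOn,
      integral_const_mul, ← integral_indicator hAm, ← integral_indicator hAm]
    linarith [Real.le_norm_self (∫ ω, A.indicator (fun ω => ‖f ω‖ ^ 2) ω ∂μ)]
  have hpos : ∀ ω, 0 ≤ A.indicator (fun ω => ‖f ω‖ ^ 2 - M * ‖f ω‖) ω := by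
    refine fun ω => Set.indicator_nonneg (fun ω (hω : M < ‖f ω‖) => ?_) ω
    nlinarith
  have h5 := (integral_eq_zero_iff_of_nonneg hpos
    ((hsq.sub (hone.const_mul M)).indicator hAm)).mp (le_antisymm h4 (integral_nonneg hpos))
  filter_upwards [h5] with ω hω
  by_contra! hlt
  have hmem : ω ∈ A := hlt
  rw [Set.indicator_of_mem hmem] at hω
  have hω' : ‖f ω‖ ^ 2 - M * ‖f ω‖ = 0 := hω
  nlinarith

variable [TopologicalSpace X] [CompactSpace X] [BorelSpace X]

lemma integrable_Lp_top_mul {μ : Measure X} [IsFiniteMeasure μ] (f : Lp ℂ ∞ μ) (g : C(X, ℂ)) :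
    Integrable (fun ω => f ω * g ω) μ :=
  ((Lp.memLp f).integrable le_top).mul_bdd (c := ‖g‖) g.continuous.aestronglyMeasurable
    (Eventually.of_forall g.norm_coe_le_norm)

variable [T2Space X]

/-- A linear functional on `C(X, ℂ)` that is bounded with respect to the `L¹` norm is given by
integration against a bounded function. -/
lemma exists_Lp_top_of_norm_le_integral_norm (μ : Measure X) [IsProbabilityMeasure μ] [μ.Regular]
    (Λ : C(X, ℂ) →ₗ[ℂ] ℂ) {M : ℝ} (hM : 0 ≤ M) (hΛ : ∀ g, ‖Λ g‖ ≤ M * ∫ ω, ‖g ω‖ ∂μ) :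
    ∃ f : Lp ℂ ∞ μ, ‖f‖ ≤ M ∧ ∀ g : C(X, ℂ), Λ g = ∫ ω, f ω * g ω ∂μ := by
  set e : C(X, ℂ) →L[ℂ] Lp ℂ 2 μ := ContinuousMap.toLp 2 μ ℂ with he
  have hdense : DenseRange e := ContinuousMap.toLp_denseRange ℂ μ ℂ ENNReal.ofNat_ne_top
  have hcoe : ∀ g : C(X, ℂ), e g =ᵐ[μ] g := fun g => ContinuousMap.coeFn_toLp μ g
  have hint : ∀ g : C(X, ℂ), ∫ ω, ‖e g ω‖ ∂μ = ∫ ω, ‖g ω‖ ∂μ := fun g =>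
    integral_congr_ae ((hcoe g).fun_comp norm)
  have hbd : ∀ g, ‖Λ g‖ ≤ M * ‖e g‖ := fun g => by
    refine (hΛ g).trans (mul_le_mul_of_nonneg_left ?_ hM)
    rw [← hint]
    exact integral_norm_le_norm_Lp_two μ (e g)
  -- The `L¹` bound is also an `L²` bound, so `Λ` extends to `L²` and Riesz representation applies.
  set Λ' : Lp ℂ 2 μ →L[ℂ] ℂ := Λ.extendOfNorm e.toLinearMap with hΛ'
  have hext : ∀ g, Λ' (e g) = Λ g := fun g =>
    LinearMap.extendOfNorm_eq (e := e.toLinearMap) hdense ⟨M, hbd⟩ g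
  have hΛ'bd : ∀ k : Lp ℂ 2 μ, ‖Λ' k‖ ≤ M * ∫ ω, ‖k ω‖ ∂μ := fun k =>
    hdense.induction_on k (isClosed_le Λ'.continuous.norm
      ((continuous_integral_norm_Lp_two μ).const_mul M)) fun g => by
        rw [hext, hint]
        exact hΛ g
  set f' : Lp ℂ 2 μ := (InnerProductSpace.toDual ℂ (Lp ℂ 2 μ)).symm Λ' with hf'
  have hinner : ∀ k, inner ℂ f' k = Λ' k := fun k => InnerProductSpace.toDual_symm_apply
  have hae : ∀ᵐ ω ∂μ, ‖f' ω‖ ≤ M := ae_norm_le_of_norm_inner_le hM fun k => by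
    rw [hinner]
    exact hΛ'bd k
  have hae' : ∀ᵐ ω ∂μ, ‖(starRingEnd ℂ) (f' ω)‖ ≤ M := by
    simpa only [RCLike.norm_conj] using hae
  -- The conjugate appears because the inner product is conjugate-linear in its first argument.
  have hmem : MemLp (fun ω => (starRingEnd ℂ) (f' ω)) ∞ μ :=
    memLp_top_of_bound (Complex.continuous_conj.comp_aestronglyMeasurable
      (Lp.aestronglyMeasurable f')) M hae'
  refine ⟨hmem.toLp _, ?_, fun g => ?_⟩
  · rw [Lp.norm_toLp, eLpNorm_exponent_top]
    refine ENNReal.toReal_le_of_le_ofReal hM (eLpNormEssSup_le_of_ae_bound hae')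
  · rw [← hext, ← hinner, L2.inner_def]
    refine integral_congr_ae ?_
    filter_upwards [hcoe g, hmem.coeFn_toLp] with ω h1 h2
    rw [h1, h2, RCLike.inner_apply, mul_comm]

/-- The conjugates lie in `L²`, where pairings with the dense continuous functions separate points.
-/
lemma Lp_top_ext_of_integral_mul {μ : Measure X} [IsProbabilityMeasure μ] [μ.Regular]
    {f₁ f₂ : Lp ℂ ∞ μ} (h : ∀ g : C(X, ℂ), ∫ ω, f₁ ω * g ω ∂μ = ∫ ω, f₂ ω * g ω ∂μ) :
    f₁ = f₂ := by
  have hdense : DenseRange (ContinuousMap.toLp 2 μ ℂ : C(X, ℂ) →L[ℂ] Lp ℂ 2 μ) :=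
    ContinuousMap.toLp_denseRange ℂ μ ℂ ENNReal.ofNat_ne_top
  have hmem : ∀ f : Lp ℂ ∞ μ, MemLp (fun ω => (starRingEnd ℂ) (f ω)) 2 μ := fun f =>
    ((Lp.memLp f).mono_exponent le_top).star
  have hin : ∀ (f : Lp ℂ ∞ μ) (g : C(X, ℂ)),
      inner ℂ ((hmem f).toLp _) (ContinuousMap.toLp 2 μ ℂ g) = ∫ ω, f ω * g ω ∂μ := by
    intro f g
    rw [L2.inner_def]
    refine integral_congr_ae ?_
    filter_upwards [ContinuousMap.coeFn_toLp (p := 2) (𝕜 := ℂ) μ g, (hmem f).coeFn_toLp]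
      with ω h1 h2
    rw [h1, h2, RCLike.inner_apply, mul_comm, Complex.conj_conj]
  have heq : (hmem f₁).toLp _ = (hmem f₂).toLp _ := by
    refine ext_inner_right ℂ fun k => ?_
    refine hdense.induction_on k (isClosed_eq (by fun_prop) (by fun_prop)) fun g => ?_
    rw [hin, hin, h]
  rw [MemLp.toLp_eq_toLp_iff] at heq
  refine Lp.ext ?_
  filter_upwards [heq] with ω hω
  exact (starRingEnd ℂ).injective hω

end Representation

/-! ### Generalized limits of means along the orbit of a one-parameter subgroup -/

/-- One fixed ultrafilter serves all test functions at once, so the limits are linear in `g` and no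
separability of `C(G)` is needed. -/
lemma exists_tendsto_hyperfilter {u : ℕ → ℂ} {M : ℝ} (hu : ∀ n, ‖u n‖ ≤ M) :
    ∃ l, Tendsto u (hyperfilter ℕ : Filter ℕ) (𝓝 l) := by
  obtain ⟨l, -, hl⟩ := (isCompact_closedBall (0 : ℂ) M).ultrafilter_le_nhds'
    ((hyperfilter ℕ).map u) (by
      exact Filter.univ_mem' (f := (hyperfilter ℕ : Filter ℕ)) fun n => by simpa using hu n)
  exact ⟨l, hl⟩

/-- After translation only two end pieces of length `|s|` fail to cancel. -/
lemma tendsto_symmMean_translate_sub {k : ℝ → ℂ} (hk : Continuous k) {M : ℝ}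
    (hM : ∀ t, ‖k t‖ ≤ M) (s : ℝ) :
    Tendsto (fun n => symmMean n fun t => k (t + s) - k t) atTop (𝓝 0) := by
  refine tendsto_symmMean_zero_of_integral_le (K := M * |s| + M * |s|) fun n => ?_
  have hi : ∀ a b, IntervalIntegrable k volume a b := fun a b => hk.intervalIntegrable a b
  have hks : Continuous fun t => k (t + s) := by fun_prop
  rw [intervalIntegral.integral_sub (hks.intervalIntegrable _ _) (hi _ _),
    intervalIntegral.integral_comp_add_right k s,
    intervalIntegral.integral_interval_sub_interval_comm (hi _ _) (hi _ _) (hi _ _)]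
  refine (norm_sub_le _ _).trans (add_le_add ?_ ?_)
  · refine (intervalIntegral.norm_integral_le_of_norm_le_const fun t _ => hM t).trans
      (le_of_eq ?_)
    rw [← abs_neg s]
    ring_nf
  · refine (intervalIntegral.norm_integral_le_of_norm_le_const fun t _ => hM t).trans
      (le_of_eq ?_)
    rw [← abs_neg s]
    ring_nf

section Group

variable {G : Type*} [TopologicalSpace G] [CommGroup G]

lemma continuous_comp_orbit (β : Multiplicative ℝ →ₜ* G) (g : C(G, ℂ)) :
    Continuous fun t : ℝ => g (β (Multiplicative.ofAdd t)) :=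
  g.continuous.comp (β.continuous_toFun.comp continuous_ofAdd)

variable [CompactSpace G]

/-- The generalized limit of the means of `F n t * g (β t)` as a functional of `g`. -/
lemma exists_linearMap_tendsto_symmMean (β : Multiplicative ℝ →ₜ* G) {F : ℕ → ℝ → ℂ} {M : ℝ}
    (hF : ∀ n, Continuous (F n)) (hM : ∀ n t, ‖F n t‖ ≤ M) :
    ∃ Λ : C(G, ℂ) →L[ℂ] ℂ, ∀ g : C(G, ℂ), Tendsto (fun n => symmMean n fun t =>
      F n t * g (β (Multiplicative.ofAdd t))) (hyperfilter ℕ : Filter ℕ) (𝓝 (Λ g)) := by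
  have hM0 : 0 ≤ M := (norm_nonneg _).trans (hM 0 0)
  have hbd : ∀ (g : C(G, ℂ)) (n : ℕ),
      ‖symmMean n fun t => F n t * g (β (Multiplicative.ofAdd t))‖ ≤ M * ‖g‖ := fun g n =>
    norm_symmMean_le n fun t => by
      rw [norm_mul]
      exact mul_le_mul (hM n t) (g.norm_coe_le_norm _) (norm_nonneg _) hM0
  choose Λ hΛ using fun g => exists_tendsto_hyperfilter (hbd g)
  refine ⟨LinearMap.mkContinuous ⟨⟨Λ, fun g h => ?_⟩, fun c g => ?_⟩ M fun g => ?_, hΛ⟩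
  · refine tendsto_nhds_unique (hΛ (g + h)) (((hΛ g).add (hΛ h)).congr fun n => ?_)
    have hg := continuous_comp_orbit β g
    have hh := continuous_comp_orbit β h
    rw [← symmMean_add n (g := fun t => F n t * g (β (Multiplicative.ofAdd t)))
      (h := fun t => F n t * h (β (Multiplicative.ofAdd t)))
      ((hF n).mul hg) ((hF n).mul hh)]
    simp only [ContinuousMap.add_apply, mul_add]
  · refine tendsto_nhds_unique (hΛ (c • g)) (((hΛ g).const_mul c).congr fun n => ?_)
    rw [← symmMean_const_mul]
    simp only [ContinuousMap.smul_apply, smul_eq_mul, mul_left_comm]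
  · exact le_of_tendsto (hΛ g).norm (Eventually.of_forall (hbd g))

variable [IsTopologicalGroup G] [MeasurableSpace G] [BorelSpace G]

/-- A dense one-parameter subgroup of a compact group is equidistributed. -/
lemma tendsto_symmMean_orbit (μ : Measure G) [μ.IsHaarMeasure] [IsProbabilityMeasure μ]
    {β : Multiplicative ℝ →ₜ* G} (hβ : DenseRange β) (g : C(G, ℂ)) :
    Tendsto (fun n => symmMean n fun t => g (β (Multiplicative.ofAdd t)))
      (hyperfilter ℕ : Filter ℕ) (𝓝 (∫ ω, g ω ∂μ)) := by
  obtain ⟨L, hL⟩ := exists_linearMap_tendsto_symmMean β (F := fun _ _ => 1) (M := 1)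
    (fun _ => continuous_const) (by simp)
  simp only [one_mul] at hL
  -- `τ x` is the translate of `g` by `x`, continuous in `x` for the uniform norm. The limit
  -- functional `L` is invariant under translation along the orbit, hence by density under all
  -- translations.
  set τ : C(G, C(G, ℂ)) := ContinuousMap.curry
    ⟨fun p : G × G => g (p.2 * p.1), g.continuous.comp (continuous_snd.mul continuous_fst)⟩
    with hτ
  have hτapp : ∀ x y, τ x y = g (y * x) := fun _ _ => rfl
  have horbit : ∀ s : ℝ, L (τ (β (Multiplicative.ofAdd s))) = L g := by
    intro s
    refine tendsto_nhds_unique (hL _) ?_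
    have h0 := ((tendsto_symmMean_translate_sub (continuous_comp_orbit β g)
      (fun t => g.norm_coe_le_norm _) s).mono_left Nat.hyperfilter_le_atTop).add (hL g)
    rw [zero_add] at h0
    refine h0.congr fun n => ?_
    have hc := continuous_comp_orbit β g
    rw [← symmMean_add n (g := fun t => g (β (Multiplicative.ofAdd (t + s))) -
      g (β (Multiplicative.ofAdd t))) ((hc.comp (continuous_add_const s)).sub hc) hc]
    simp only [sub_add_cancel, hτapp, ofAdd_add, map_mul]
  have hconst : ∀ x, L (τ x) = L g := fun x =>
    hβ.induction_on x (isClosed_eq (by fun_prop) continuous_const) fun s => horbit s.toAdd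
  have hτint : Integrable τ μ := τ.continuous.integrable_of_hasCompactSupport
    (HasCompactSupport.of_compactSpace _)
  have hmean : ∫ x, τ x ∂μ = ContinuousMap.const G (∫ ω, g ω ∂μ) := by
    ext y
    rw [ContinuousMap.integral_apply hτint]
    simp only [hτapp, ContinuousMap.const_apply]
    exact integral_mul_left_eq_self (fun x => g x) y
  -- Averaging the translates over Haar measure gives the constant `∫ g`, and the continuous `L`
  -- commutes with that average.
  have h1 : L g = L (∫ x, τ x ∂μ) := by
    rw [← L.integral_comp_comm hτint]
    simp [hconst]
  have h2 : L g = ∫ ω, g ω ∂μ := by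
    rw [h1, hmean]
    refine tendsto_nhds_unique (hL _) (tendsto_const_nhds.congr fun n => ?_)
    exact (symmMean_const n _).symm
  rw [← h2]
  exact hL g

variable [T2Space G]

/-- A bounded family of functions on the line induces a bounded function on the group. -/
lemma exists_Lp_top_tendsto_symmMean (μ : Measure G) [μ.IsHaarMeasure] [IsProbabilityMeasure μ]
    [μ.Regular] {β : Multiplicative ℝ →ₜ* G} (hβ : DenseRange β) {F : ℕ → ℝ → ℂ} {M : ℝ}
    (hF : ∀ n, Continuous (F n)) (hM : ∀ n t, ‖F n t‖ ≤ M) :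
    ∃ f : Lp ℂ ∞ μ, ‖f‖ ≤ M ∧ ∀ g : C(G, ℂ), Tendsto (fun n => symmMean n fun t =>
      F n t * g (β (Multiplicative.ofAdd t))) (hyperfilter ℕ : Filter ℕ)
      (𝓝 (∫ ω, f ω * g ω ∂μ)) := by
  obtain ⟨Λ, hΛ⟩ := exists_linearMap_tendsto_symmMean β hF hM
  obtain ⟨f, hfM, hf⟩ := exists_Lp_top_of_norm_le_integral_norm μ Λ.toLinearMap
    ((norm_nonneg _).trans (hM 0 0)) (M := M) fun g => by
      -- The means of `F g` are dominated by those of `M |g|`, which tend to `M ∫ |g|` by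
      -- equidistribution.
      set k : C(G, ℂ) := ⟨fun ω => ((M * ‖g ω‖ : ℝ) : ℂ), by fun_prop⟩ with hk
      have h1 := (Complex.continuous_re.tendsto _).comp (tendsto_symmMean_orbit μ hβ k)
      have h2 : (∫ ω, k ω ∂μ).re = M * ∫ ω, ‖g ω‖ ∂μ := by
        change (∫ ω, ((M * ‖g ω‖ : ℝ) : ℂ) ∂μ).re = _
        rw [integral_complex_ofReal, Complex.ofReal_re, integral_const_mul]
      rw [h2] at h1
      refine le_of_tendsto_of_tendsto (hΛ g).norm h1 (Eventually.of_forall fun n => ?_)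
      refine norm_symmMean_le_re n
        (continuous_const.mul (continuous_comp_orbit β g).norm) fun t => ?_
      rw [norm_mul]
      exact mul_le_mul_of_nonneg_right (hM n t) (norm_nonneg _)
  exact ⟨f, hfM, fun g => (hf g) ▸ hΛ g⟩

end Group

/-! ### The Bohr transform -/

lemma norm_boundedExtension_le {lam : Frequency} (D : Dext lam) {s : ℂ} (hs : 0 < s.re) :
    ‖boundedExtension D s‖ ≤ supNorm D := by
  obtain ⟨C, hC⟩ := (D.2.2.choose_spec : IsBoundedExtension lam D (boundedExtension D)).bounded
  exact le_ciSup (f := fun s : {s : ℂ // 0 < s.re} => ‖boundedExtension D s‖)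
    ⟨C, by rintro _ ⟨z, rfl⟩; exact hC z z.2⟩ ⟨s, hs⟩

lemma isBoundedExtension_boundedExtension {lam : Frequency} (D : Dext lam) :
    IsBoundedExtension lam D (boundedExtension D) :=
  D.2.2.choose_spec

lemma IsBoundedExtension.add {lam : Frequency} {a b : ℕ → ℂ} {f g : ℂ → ℂ}
    (ha : ∃ s l : ℂ, HasSumAt lam a s l) (hb : ∃ s l : ℂ, HasSumAt lam b s l)
    (hf : IsBoundedExtension lam a f) (hg : IsBoundedExtension lam b g) :
    IsBoundedExtension lam (a + b) (f + g) := by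
  obtain ⟨s, l, hs⟩ := ha
  obtain ⟨t, m, ht⟩ := hb
  obtain ⟨C, hC⟩ := hf.bounded
  obtain ⟨C', hC'⟩ := hg.bounded
  obtain ⟨σ, hσ⟩ := hf.extend
  obtain ⟨τ, hτ⟩ := hg.extend
  refine ⟨hf.holomorphic.add hg.holomorphic, ⟨C + C', fun z hz => ?_⟩,
    max (max σ τ) (max s.re t.re), fun z hz hz' n hn => ?_⟩
  · exact (norm_add_le _ _).trans (add_le_add (hC z hz) (hC' z hz))
  · simp only [max_lt_iff] at hz'
    obtain ⟨p, hp⟩ := exists_hasSumAt_of_re_lt lam hs hz'.2.1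
    obtain ⟨q, hq⟩ := exists_hasSumAt_of_re_lt lam ht hz'.2.2
    rw [Pi.add_apply, hσ z hz hz'.1.1 p hp, hτ z hz hz'.1.2 q hq]
    refine tendsto_nhds_unique ((Tendsto.add hp hq).congr fun N => ?_) hn
    simp [partialSum, add_mul, Finset.sum_add_distrib]

lemma IsBoundedExtension.smul {lam : Frequency} {a : ℕ → ℂ} {f : ℂ → ℂ}
    (ha : ∃ s l : ℂ, HasSumAt lam a s l) (hf : IsBoundedExtension lam a f) (c : ℂ) :
    IsBoundedExtension lam (c • a) (c • f) := by
  obtain ⟨s, l, hs⟩ := ha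
  obtain ⟨C, hC⟩ := hf.bounded
  obtain ⟨σ, hσ⟩ := hf.extend
  refine ⟨hf.holomorphic.const_smul c, ⟨‖c‖ * C, fun z hz => ?_⟩,
    max σ s.re, fun z hz hz' n hn => ?_⟩
  · rw [Pi.smul_apply, norm_smul]
    exact mul_le_mul_of_nonneg_left (hC z hz) (norm_nonneg _)
  · simp only [max_lt_iff] at hz'
    obtain ⟨p, hp⟩ := exists_hasSumAt_of_re_lt lam hs hz'.2
    rw [Pi.smul_apply, hσ z hz hz'.1 p hp, smul_eq_mul]
    refine tendsto_nhds_unique ((Tendsto.const_mul c hp).congr fun N => ?_) hn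
    simp [partialSum, Finset.mul_sum, mul_assoc]

/-- `boundedExtension` is merely chosen; additivity comes from uniqueness of the extension, and so
holds only on `Re > 0`. -/
lemma boundedExtension_add {lam : Frequency} (D E : Dext lam) {s : ℂ} (hs : 0 < s.re) :
    boundedExtension (D + E) s = boundedExtension D s + boundedExtension E s :=
  (isBoundedExtension_boundedExtension (D + E)).eqOn (D + E).2.1
    ((isBoundedExtension_boundedExtension D).add D.2.1 E.2.1
      (isBoundedExtension_boundedExtension E)) hs

lemma boundedExtension_smul {lam : Frequency} (c : ℂ) (D : Dext lam) {s : ℂ} (hs : 0 < s.re) :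
    boundedExtension (c • D) s = c * boundedExtension D s :=
  (isBoundedExtension_boundedExtension (c • D)).eqOn (c • D).2.1
    ((isBoundedExtension_boundedExtension D).smul D.2.1 c) hs

/-- The restriction of the bounded extension of `D` to the line `Re = 1 / (n + 1)`. -/
def verticalLine {lam : Frequency} (D : Dext lam) (n : ℕ) (t : ℝ) : ℂ :=
  boundedExtension D ((1 / ((n : ℝ) + 1) : ℝ) + t * Complex.I)

lemma re_verticalLine_pos (n : ℕ) (t : ℝ) :
    0 < (((1 / ((n : ℝ) + 1) : ℝ) : ℂ) + t * Complex.I).re := by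
  have : (0 : ℝ) < 1 / ((n : ℝ) + 1) := by positivity
  rwa [Complex.add_re, Complex.re_ofReal_mul, Complex.I_re, mul_zero, add_zero, Complex.ofReal_re]

lemma continuous_verticalLine {lam : Frequency} (D : Dext lam) (n : ℕ) :
    Continuous (verticalLine D n) :=
  (isBoundedExtension_boundedExtension D).continuous_vertical (by positivity)

section Group

variable {G : Type*} [TopologicalSpace G] [CommGroup G]

lemma IsDirichletGroup.char_apply {lam : Frequency} {β : Multiplicative ℝ →ₜ* G}
    (hβ : IsDirichletGroup lam β) (n : ℕ) (t : ℝ) :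
    (hβ.char n (β (Multiplicative.ofAdd t)) : ℂ) =
      Complex.exp (-Complex.I * (lam.seq n : ℂ) * (t : ℂ)) :=
  (hβ.exists_char n).choose_spec t

lemma exists_char_orbit_eq_exp (β : Multiplicative ℝ →ₜ* G) (γ : PontryaginDual G) :
    ∃ x : ℝ, ∀ t : ℝ, (γ (β (Multiplicative.ofAdd t)) : ℂ) =
      Complex.exp (-Complex.I * x * t) := by
  refine exists_eq_exp_of_map_add ?_ (fun s t => ?_) fun t => Circle.norm_coe _
  · exact continuous_subtype_val.comp
      ((map_continuous γ).comp (β.continuous_toFun.comp continuous_ofAdd))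
  · rw [ofAdd_add, map_mul, map_mul, Circle.coe_mul]

lemma conj_exp_neg_I_mul (x t : ℝ) :
    (starRingEnd ℂ) (Complex.exp (-Complex.I * x * t)) = Complex.exp (Complex.I * x * t) := by
  rw [← Complex.exp_conj]
  simp

variable [MeasurableSpace G]

/-- `f` is the function on `G` induced by the bounded extension of `D`. -/
def IsBohrTransform (μ : Measure G) (β : Multiplicative ℝ →ₜ* G)
    {lam : Frequency} (D : Dext lam) (f : Lp ℂ ∞ μ) : Prop :=
  ∀ g : C(G, ℂ), Tendsto (fun n => symmMean n fun t =>
    verticalLine D n t * g (β (Multiplicative.ofAdd t))) (hyperfilter ℕ : Filter ℕ)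
    (𝓝 (∫ ω, f ω * g ω ∂μ))

variable {μ : Measure G} {lam : Frequency} {β : Multiplicative ℝ →ₜ* G}

lemma IsBohrTransform.smul {D : Dext lam} {f : Lp ℂ ∞ μ} (h : IsBohrTransform μ β D f) (c : ℂ) :
    IsBohrTransform μ β (c • D) (c • f) := by
  intro g
  have h3 : ∫ ω, (c • f : Lp ℂ ∞ μ) ω * g ω ∂μ = c * ∫ ω, f ω * g ω ∂μ := by
    rw [← integral_const_mul]
    refine integral_congr_ae ?_
    filter_upwards [Lp.coeFn_smul c f] with ω hω
    rw [hω, Pi.smul_apply, smul_eq_mul, mul_assoc]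
  rw [h3]
  refine ((h g).const_mul c).congr fun n => ?_
  rw [← symmMean_const_mul]
  congr 1
  funext t
  rw [← mul_assoc, verticalLine, verticalLine,
    boundedExtension_smul c D (re_verticalLine_pos n t)]

lemma IsBohrTransform.tendsto_fourierTransform {D : Dext lam} {f : Lp ℂ ∞ μ}
    (hf : IsBohrTransform μ β D f) {γ : PontryaginDual G} {x : ℝ}
    (hγ : ∀ t : ℝ, (γ (β (Multiplicative.ofAdd t)) : ℂ) = Complex.exp (-Complex.I * x * t)) :
    Tendsto (fun n => symmMean n fun t => verticalLine D n t * Complex.exp (Complex.I * x * t))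
      (hyperfilter ℕ : Filter ℕ) (𝓝 (fourierTransform μ f γ)) := by
  have hc : Continuous fun ω : G => (starRingEnd ℂ) (γ ω : ℂ) :=
    Complex.continuous_conj.comp (continuous_subtype_val.comp (map_continuous γ))
  have h := hf ⟨fun ω => (starRingEnd ℂ) (γ ω : ℂ), hc⟩
  simp only [ContinuousMap.coe_mk, hγ, conj_exp_neg_I_mul] at h
  exact h

lemma IsBohrTransform.fourierTransform_char {D : Dext lam} {f : Lp ℂ ∞ μ}
    (hf : IsBohrTransform μ β D f) (hβ : IsDirichletGroup lam β) (n : ℕ) :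
    fourierTransform μ f (hβ.char n) = (D : ℕ → ℂ) n :=
  tendsto_nhds_unique (hf.tendsto_fourierTransform (hβ.char_apply n))
    (((isBoundedExtension_boundedExtension D).tendsto_symmMean_seq D.2.1 n).mono_left
      Nat.hyperfilter_le_atTop)

variable [BorelSpace G] [IsProbabilityMeasure μ]

/-- If `γ ∘ β` is `e^{-ixt}` with `x` a frequency, density of the orbit identifies `γ`; otherwise
the limit of means giving the coefficient is `0`. -/
lemma IsBohrTransform.mem_hardyInfty {D : Dext lam} {f : Lp ℂ ∞ μ}
    (hf : IsBohrTransform μ β D f) (hβ : IsDirichletGroup lam β) : f ∈ hardyInfty μ hβ := by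
  intro γ hγ
  obtain ⟨x, hx⟩ := exists_char_orbit_eq_exp β γ
  by_cases h : ∃ n, lam.seq n = x
  · obtain ⟨n, rfl⟩ := h
    exact ⟨n, (hβ.eq_char hx).symm⟩
  · push Not at h
    exact absurd (tendsto_nhds_unique (hf.tendsto_fourierTransform hx)
      (((isBoundedExtension_boundedExtension D).tendsto_symmMean_of_ne D.2.1 h).mono_left
        Nat.hyperfilter_le_atTop)) hγ

variable [CompactSpace G]

lemma IsBohrTransform.add {D E : Dext lam} {f₁ f₂ : Lp ℂ ∞ μ} (h₁ : IsBohrTransform μ β D f₁)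
    (h₂ : IsBohrTransform μ β E f₂) : IsBohrTransform μ β (D + E) (f₁ + f₂) := by
  intro g
  have h3 : ∫ ω, (f₁ + f₂ : Lp ℂ ∞ μ) ω * g ω ∂μ =
      ∫ ω, f₁ ω * g ω ∂μ + ∫ ω, f₂ ω * g ω ∂μ := by
    rw [← integral_add (integrable_Lp_top_mul f₁ g) (integrable_Lp_top_mul f₂ g)]
    refine integral_congr_ae ?_
    filter_upwards [Lp.coeFn_add f₁ f₂] with ω hω
    rw [hω, Pi.add_apply, add_mul]
  rw [h3]
  refine ((h₁ g).add (h₂ g)).congr fun n => ?_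
  have hg := continuous_comp_orbit β g
  rw [← symmMean_add n (g := fun t => verticalLine D n t * g (β (Multiplicative.ofAdd t)))
    (h := fun t => verticalLine E n t * g (β (Multiplicative.ofAdd t)))
    ((continuous_verticalLine D n).mul hg)
    ((continuous_verticalLine E n).mul hg)]
  congr 1
  funext t
  rw [← add_mul, verticalLine, verticalLine, verticalLine,
    boundedExtension_add D E (re_verticalLine_pos n t)]

variable [T2Space G] [μ.Regular]

lemma IsBohrTransform.unique {D : Dext lam} {f₁ f₂ : Lp ℂ ∞ μ} (h₁ : IsBohrTransform μ β D f₁)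
    (h₂ : IsBohrTransform μ β D f₂) : f₁ = f₂ :=
  Lp_top_ext_of_integral_mul fun g => tendsto_nhds_unique (h₁ g) (h₂ g)

lemma exists_isBohrTransform [IsTopologicalGroup G] [μ.IsHaarMeasure] (hβ : DenseRange β) (D : Dext lam) :
    ∃ f : Lp ℂ ∞ μ, ‖f‖ ≤ supNorm D ∧ IsBohrTransform μ β D f :=
  exists_Lp_top_tendsto_symmMean μ hβ (continuous_verticalLine D)
    fun n t => norm_boundedExtension_le D (re_verticalLine_pos n t)

end Group

end GenDirichlet

end

/-! ### The embedding into the Hardy space and the coefficient inequality. -/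

theorem mainTheorem8 (lam : GenDirichlet.Frequency) :
    (∀ (G : Type*) [TopologicalSpace G] [CommGroup G] [IsTopologicalGroup G] [CompactSpace G]
        [T2Space G] [MeasurableSpace G] [BorelSpace G]
        (μ : Measure G) [μ.IsHaarMeasure] [IsProbabilityMeasure μ] [μ.Regular]
        (β : Multiplicative ℝ →ₜ* G) (hβ : GenDirichlet.IsDirichletGroup lam β),
        ∃ Ψ : GenDirichlet.Dext lam →ₗ[ℂ] GenDirichlet.hardyInfty μ hβ,
          Function.Injective Ψ ∧
          (∀ D : GenDirichlet.Dext lam, ‖Ψ D‖ ≤ GenDirichlet.supNorm D) ∧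
          ∀ (D : GenDirichlet.Dext lam) (n : ℕ),
            (D : ℕ → ℂ) n =
              GenDirichlet.fourierTransform μ ((Ψ D : Lp ℂ ∞ μ) : G → ℂ) (hβ.char n)) ∧
    ∀ D : GenDirichlet.Dext lam,
      Summable (fun n => ‖(D : ℕ → ℂ) n‖ ^ 2) ∧
        Real.sqrt (∑' n, ‖(D : ℕ → ℂ) n‖ ^ 2) ≤ GenDirichlet.supNorm D := by
  refine ⟨?_, fun D => ?_⟩
  · intro G _ _ _ _ _ _ _ μ _ _ _ β hβ
    choose f hfnorm hf using fun D : GenDirichlet.Dext lam =>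
      GenDirichlet.exists_isBohrTransform (μ := μ) hβ.denseRange D
    have hcoef : ∀ (D : GenDirichlet.Dext lam) (n : ℕ),
        (D : ℕ → ℂ) n = GenDirichlet.fourierTransform μ (f D : G → ℂ) (hβ.char n) :=
      fun D n => ((hf D).fourierTransform_char hβ n).symm
    -- The `f D` are chosen separately for each `D`; linearity holds because sums and multiples of
    -- transforms are transforms, and a transform is unique.
    refine ⟨{ toFun := fun D => ⟨f D, (hf D).mem_hardyInfty hβ⟩
              map_add' := fun D E => Subtype.ext ((hf (D + E)).unique ((hf D).add (hf E)))
              map_smul' := fun c D => Subtype.ext ((hf (c • D)).unique ((hf D).smul c)) },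
      fun D E hDE => ?_, hfnorm, hcoef⟩
    have h : f D = f E := congrArg Subtype.val hDE
    refine Subtype.ext (funext fun n => ?_)
    rw [hcoef D n, hcoef E n, h]
  · have hsum := (GenDirichlet.isBoundedExtension_boundedExtension D).sum_norm_sq_le D.2.1
      fun s hs => GenDirichlet.norm_boundedExtension_le D hs
    have h0 : 0 ≤ GenDirichlet.supNorm D :=
      (norm_nonneg _).trans (GenDirichlet.norm_boundedExtension_le D (s := 1) (by simp))
    refine ⟨summable_of_sum_range_le (fun n => by positivity) hsum, ?_⟩
    exact Real.sqrt_le_iff.mpr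
      ⟨h0, Real.tsum_le_of_sum_range_le (fun n => by positivity) hsum⟩
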